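/- **Definitions.** A *cotree* is a rooted tree in which every internal node has at least two children and carries a type, $0$ or $1$, such that types alternate along every root–leaf path; cotrees are considered up to permutations of siblings. The graph associated with a cotree has the leaves as vertices; a type-$0$ node stands for the disjoint union, and a type-$1$ node for the join, of the graphs associated with its children. *Cographs* are the graphs obtained from one-vertex graphs by taking complements and disjoint unions. Let $\mathbb T_n$ be the set of rooted trees with $n$ leaves in which every internal node has at least two children. For a node $v$ let $l(v)$ be the number of leaves of the subtree $T(v)$ rooted at $v$. The children of every node are listed in a fixed order with non-decreasing values of $l$; if $v$ has children $v_1,\dots,v_k$, it *induces* the partition $(l(v_1),\dots,l(v_k))$ of $l(v)$. Partitions of $m\ge 2$ are non-decreasing, have at least two parts, and are ordered lexicographically; the least one is $(1,\dots,1)$ and the greatest one is $(\lfloor m/2\rfloor,\lceil m/2\rceil)$. A node is *exhausted* if it is a leaf or induces the greatest partition of $l(v)$. The *pivot* of $T$ is the first non-exhausted node in the traversal that visits, recursively, the subtrees of the children from last to first and then the node itself. $\mathit{RebuildNode}(v,(a_1,\dots,a_k))$ replaces the subtree at $v$ by one in which $v$ has $k$ children, the $i$-th of which is a leaf if $a_i=1$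 and has $a_i$ leaves as children if $a_i>1$. $\mathit{NextPartition}(a_1,\dots,a_k)$, for a partition of $m$, is computed as follows. If $a_1\ne\lfloor m/2\rfloor$: return $(a_1,\dots,a_{k-2},a_{k-1}+a_k)$ if $a_k-a_{k-1}\le 1$; otherwise put $p=a_{k-1}+1$, $s=a_k-1$, $q=\lfloor s/p\rfloor$, $r=s \bmod p$, and return $(a_1,\dots,a_{k-2},p,\dots,p,p+r)$ with $q$ copies of $p$ before the last part if $q>1$, and $(a_1,\dots,a_{k-2},p,s)$ if $q=1$. If $a_1=\lfloor m/2\rfloor$: return $(1,2)$ for the partition $(1,1,1)$ of $3$, and null otherwise. $\mathit{NextTree}(T)$ returns null if $T$ has no pivot. Otherwise let $v$ be the pivot; rebuild $v$ with the partition $\mathit{NextPartition}(a)$, where $a$ is the partition induced by $v$; then, for $x=v$ and successively for each ancestor $x$ of $v$ up to the root, replace, for every sibling $y$ after $x$, the subtree $T(y)$ by a copy of $T(x)$ if $l(y)=l(x)$, and rebuild $y$ with the partition $(1,\dots,1)$ of $l(y)$ otherwise. The resulting tree is returned. $\mathit{CographGeneration}(n)$, for $n\ge 2$: let $T_1\in\mathbb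 T_n$ be the tree whose root has $n$ leaves as children; for $i=1,2,\dots$ output $T_i^0$ and $T_i^1$, the cotrees obtained from $T_i$ by giving the root type $0$, respectively $1$, and let $T_{i+1}=\mathit{NextTree}(T_i)$; stop when this is null. Running time is measured on a pointer machine in which every elementary operation (creating or reading a cell, arithmetic on or comparison of two integers, procedure call or return) takes one unit of time and an output takes time equal to its size. **Theorem.** Let $n\ge 2$ be an integer. Then $\mathit{CographGeneration}(n)$ halts, and: (a) the sequence $T_1^0,T_1^1,T_2^0,T_2^1,\dots$ of its outputs consists of cotrees with $n$ leaves and contains every cotree with $n$ leaves (up to permutations of siblings); (b) the graphs associated with these cotrees are cographs with $n$ vertices, every cograph with $n$ vertices is isomorphic to one of them, and no two of them are isomorphic; (c) the delay of the algorithm is $O(n)$: there is a constant $C$, independent of $n$, such that at most $Cn$ units of time pass between any two consecutive outputs, and also between the last output and the halt; (d) the first output is complete after $O(n)$ units of time. -/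

import Mathlib

/-! ## Cotrees -/

/-- Plane rooted trees whose internal nodes carry a type: `false` for type 0, `true` for type 1. -/
inductive Cotree : Type
  | leaf : Cotree
  | node (type : Bool) (children : List Cotree) : Cotree

namespace Cotree

/-- The type of the root, if the root is an internal node. -/
def rootType : Cotree → Option Bool
  | leaf => none
  | node b _ => some b

mutual
/-- The number of leaves. -/
def numLeaves : Cotree → ℕ
  | leaf => 1
  | node _ cs => numLeavesList cs
/-- The total number of leaves of a list of trees. -/
def numLeavesList : List Cotree → ℕ
  | [] => 0
  | c :: cs => numLeaves c + numLeavesList cs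
end

/-- Cotrees: every internal node has at least two children, and types alternate on every
path from the root to a leaf. -/
inductive IsCotree : Cotree → Prop
  | leaf : IsCotree leaf
  | node (b : Bool) (cs : List Cotree) (two_le : 2 ≤ cs.length)
      (isCotree : ∀ c ∈ cs, IsCotree c) (alternate : ∀ c ∈ cs, c.rootType ≠ some b) :
      IsCotree (node b cs)

/-- `SibEquiv c d`: the tree `c` can be converted into `d` by sibling permutations. -/
inductive SibEquiv : Cotree → Cotree → Prop
  | refl (c : Cotree) : SibEquiv c c
  | trans {c d e : Cotree} : SibEquiv c d → SibEquiv d e → SibEquiv c e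
  | perm (b : Bool) {cs ds : List Cotree} : cs.Perm ds → SibEquiv (node b cs) (node b ds)
  | child (b : Bool) (l r : List Cotree) {c d : Cotree} : SibEquiv c d →
      SibEquiv (node b (l ++ c :: r)) (node b (l ++ d :: r))

mutual
/-- The vertex set of the graph of a cotree: one vertex for each leaf. -/
def Vert : Cotree → Type
  | leaf => Unit
  | node _ cs => VertList cs
/-- One vertex for each leaf of each tree of a list. -/
def VertList : List Cotree → Type
  | [] => Empty
  | c :: cs => Vert c ⊕ VertList cs
end

end Cotree

/-- The join of two graphs: their disjoint union, together with all edges between the two sides. -/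
def graphJoin {V W : Type*} (G : SimpleGraph V) (H : SimpleGraph W) : SimpleGraph (V ⊕ W) :=
  (G ⊕g H) ⊔ completeBipartiteGraph V W

namespace Cotree

mutual
/-- The graph associated with a cotree: a type-0 node is the disjoint union, and a type-1 node
the join, of the graphs of its children. -/
def graph : (c : Cotree) → SimpleGraph (Vert c)
  | leaf => (⊥ : SimpleGraph Unit)
  | node b cs => graphList b cs
/-- The disjoint union (`b = false`) or the join (`b = true`) of the graphs of a list of trees. -/
def graphList (b : Bool) : (cs : List Cotree) → SimpleGraph (VertList cs)
  | [] => (⊥ : SimpleGraph Empty)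
  | c :: cs =>
    match b with
    | false => graph c ⊕g graphList false cs
    | true => graphJoin (graph c) (graphList true cs)
end

end Cotree

/-- Cographs: the smallest class of graphs, closed under isomorphism, that contains the one-vertex
graphs and is closed under complements and disjoint unions. -/
inductive IsCograph.{u} : {V : Type u} → SimpleGraph V → Prop
  | single {V : Type u} [Subsingleton V] [Nonempty V] (G : SimpleGraph V) : IsCograph G
  | compl {V : Type u} {G : SimpleGraph V} : IsCograph G → IsCograph Gᶜ
  | union {V W : Type u} {G : SimpleGraph V} {H : SimpleGraph W} :
      IsCograph G → IsCograph H → IsCograph (G ⊕g H)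
  | iso {V W : Type u} {G : SimpleGraph V} {H : SimpleGraph W} (e : G ≃g H) :
      IsCograph G → IsCograph H

/-! ## A machine with unit-cost elementary operations

Data are natural numbers, a null pointer, and cells that hold two data. Each elementary operation,
test, procedure call and return takes one unit of time; an output takes the time needed to write
all of it. -/

/-- Data of the machine. -/
inductive Val : Type
  | num (m : ℕ) : Val
  | nil : Val
  | cons (a b : Val) : Val

namespace Val

/-- First component of a cell. -/
def head : Val → Val
  | cons a _ => a
  | _ => nil

/-- Second component of a cell. -/
def tail : Val → Val
  | cons _ b => b
  | _ => nil

/-- The number held by a datum. -/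
def toNat : Val → ℕ
  | num m => m
  | _ => 0

/-- Is the datum the null pointer? -/
def isNil : Val → Bool
  | nil => true
  | _ => false

/-- The number of symbols of a datum. -/
def size : Val → ℕ
  | num _ => 1
  | nil => 1
  | cons a b => a.size + b.size + 1

end Val

/-- Names of the procedures. -/
inductive Proc : Type
  | revAppend | sum | ones | repeatPush | nextPartition
  | leafList | rebuildChildren | rebuildNode
  | inducedPartition | findPivot | findPivotAmong
  | copy | copyList | restart | climb | nextTree
  | toCotree | toCotreeList
  | loop | cographGeneration

/-- Straight-line code with branching, whose variables hold data of type `V`. An operation passes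
its result on to the code that follows it. Procedure bodies are written for an arbitrary type `V`,
so that they can inspect their data only through the operations listed here. -/
inductive Code (V : Type) : Type
  /-- Return from the current procedure. -/
  | ret (x : V)
  | num (m : ℕ) (next : V → Code V)
  | nil (next : V → Code V)
  | cons (x y : V) (next : V → Code V)
  | head (x : V) (next : V → Code V)
  | tail (x : V) (next : V → Code V)
  | add (x y : V) (next : V → Code V)
  | sub (x y : V) (next : V → Code V)
  | div (x y : V) (next : V → Code V)
  | mod (x y : V) (next : V → Code V)
  | ifNil (x : V) (yes no : Code V)
  | ifEq (x y : V) (yes no : Code V)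
  | ifLe (x y : V) (yes no : Code V)
  /-- Call a procedure and go on with its result. -/
  | call (p : Proc) (args : List V) (next : V → Code V)
  /-- Continue with the body of a procedure, without coming back. -/
  | jump (p : Proc) (args : List V)
  | output (x : V) (next : Code V)

/-! ## The procedures

Partitions are lists of numbers. A node of a labeled tree is a cell with the number of leaves below
the node and the list of its children; thus a leaf is `cons 1 nil`. The value `nil` also serves as
*null*. -/

namespace Code

variable {V : Type}

/-- The reversal of `xs`, followed by `ys`. -/
def revAppend (xs ys : V) : Code V :=
  .ifNil xs (.ret ys) <|
  .head xs fun x =>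
  .tail xs fun xs' =>
  .cons x ys fun ys' =>
  .jump .revAppend [xs', ys']

/-- The sum of a list of numbers, added to `s`. -/
def sum (xs s : V) : Code V :=
  .ifNil xs (.ret s) <|
  .head xs fun x =>
  .tail xs fun xs' =>
  .add s x fun s' =>
  .jump .sum [xs', s']

/-- The list of `m` ones. -/
def ones (m : V) : Code V :=
  .num 0 fun zero =>
  .num 1 fun one =>
  .nil fun null =>
  .ifEq m zero (.ret null) <|
  .sub m one fun m' =>
  .call .ones [m'] fun xs =>
  .cons one xs fun r =>
  .ret r

/-- Put `q` copies of `x` in front of `ys`. -/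
def repeatPush (q x ys : V) : Code V :=
  .num 0 fun zero =>
  .num 1 fun one =>
  .ifEq q zero (.ret ys) <|
  .sub q one fun q' =>
  .cons x ys fun ys' =>
  .jump .repeatPush [q', x, ys']

/-- The partition immediately next to the partition `a`, or null. Here `ak`, `ak1` are the last two
components of `a`, and `front` is the reversed list of the other components. -/
def nextPartition (a : V) : Code V :=
  .num 0 fun zero =>
  .num 1 fun one =>
  .num 2 fun two =>
  .num 3 fun three =>
  .nil fun null =>
  .call .sum [a, zero] fun n =>
  .head a fun a1 =>
  .div n two fun half =>
  .ifEq a1 half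
    (.ifEq n three
      (.tail a fun t =>
       .head t fun a2 =>
       .add n one fun n' =>
       .div n' two fun half' =>
       .ifEq a2 half'
        (.ret null)
        (.cons two null fun u =>
         .cons one u fun r =>
         .ret r))
      (.ret null))
    (.call .revAppend [a, null] fun rev =>
     .head rev fun ak =>
     .tail rev fun rev' =>
     .head rev' fun ak1 =>
     .tail rev' fun front =>
     .sub ak ak1 fun d =>
     .ifLe d one
      (.add ak1 ak fun s =>
       .cons s null fun b =>
       .jump .revAppend [front, b])
      (.add ak1 one fun bk1 =>
       .sub ak one fun bk =>
       .div bk bk1 fun q =>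
       .mod bk bk1 fun r =>
       .ifLe q one
        (.cons bk null fun b =>
         .cons bk1 b fun b' =>
         .jump .revAppend [front, b'])
        (.add bk1 r fun last =>
         .cons last null fun b =>
         .call .repeatPush [q, bk1, b] fun b' =>
         .jump .revAppend [front, b'])))

/-- A list of `m` leaves. -/
def leafList (m : V) : Code V :=
  .num 0 fun zero =>
  .num 1 fun one =>
  .nil fun null =>
  .ifEq m zero (.ret null) <|
  .sub m one fun m' =>
  .call .leafList [m'] fun xs =>
  .cons one null fun leaf =>
  .cons leaf xs fun r =>
  .ret r

/-- For each component `x` of the partition `a`, a node with label `x`, which has `x` leaves as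
children if `x > 1`. -/
def rebuildChildren (a : V) : Code V :=
  .num 1 fun one =>
  .nil fun null =>
  .ifNil a (.ret null) <|
  .head a fun x =>
  .tail a fun a' =>
  .call .rebuildChildren [a'] fun vs =>
  .ifLe x one
    (.cons x null fun v =>
     .cons v vs fun r =>
     .ret r)
    (.call .leafList [x] fun ls =>
     .cons x ls fun v =>
     .cons v vs fun r =>
     .ret r)

/-- The new subtree at a node with `m` leaves whose induced partition becomes `a`. -/
def rebuildNode (m a : V) : Code V :=
  .call .rebuildChildren [a] fun vs =>
  .cons m vs fun r =>
  .ret r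

/-- The labels of the nodes in the list `vs`. -/
def inducedPartition (vs : V) : Code V :=
  .nil fun null =>
  .ifNil vs (.ret null) <|
  .head vs fun v =>
  .tail vs fun vs' =>
  .head v fun x =>
  .call .inducedPartition [vs'] fun xs =>
  .cons x xs fun r =>
  .ret r

/-- Search for the first node, in inverted post-order, of the subtree at `v` that is not exhausted.
The result is null, or a cell with the subtree at the pivot and the path from the pivot to the
root. A path is a list with one entry for each node `x` on it other than the root: the label of the
parent of `x`, the reversed list of the siblings before `x`, and the list of the siblings
after `x`. The parameter `path` is the path from `v` to the root. -/
def findPivot (v path : V) : Code V :=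
  .num 1 fun one =>
  .num 2 fun two =>
  .nil fun null =>
  .head v fun m =>
  .tail v fun vs =>
  .ifNil vs (.ret null) <|
  .call .revAppend [vs, null] fun rev =>
  .call .findPivotAmong [m, rev, null, path] fun r =>
  .ifNil r
    (.cons v path fun here =>
     .div m two fun lo =>
     .add m one fun m' =>
     .div m' two fun hi =>
     .head vs fun v1 =>
     .head v1 fun a1 =>
     .tail vs fun vs' =>
     .head vs' fun v2 =>
     .head v2 fun a2 =>
     .ifEq a1 lo
      (.ifEq a2 hi (.ret null) (.ret here))
      (.ret here))
    (.ret r)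

/-- The same search in the subtrees at the nodes of `rev`, which is the reversed list of those
children of a node with label `m` that are not yet visited; `visited` lists the other children. -/
def findPivotAmong (m rev visited path : V) : Code V :=
  .nil fun null =>
  .ifNil rev (.ret null) <|
  .head rev fun v =>
  .tail rev fun before =>
  .cons before visited fun sibs =>
  .cons m sibs fun entry =>
  .cons entry path fun path' =>
  .call .findPivot [v, path'] fun r =>
  .ifNil r
    (.cons v visited fun visited' =>
     .jump .findPivotAmong [m, before, visited', path])
    (.ret r)

/-- A copy of the subtree at `v`. -/
def copy (v : V) : Code V :=
  .head v fun m =>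
  .tail v fun vs =>
  .call .copyList [vs] fun vs' =>
  .cons m vs' fun r =>
  .ret r

/-- A copy of a list of subtrees. -/
def copyList (vs : V) : Code V :=
  .nil fun null =>
  .ifNil vs (.ret null) <|
  .head vs fun v =>
  .tail vs fun vs' =>
  .call .copy [v] fun w =>
  .call .copyList [vs'] fun ws =>
  .cons w ws fun r =>
  .ret r

/-- For each sibling `y` in the list `ys` of those after `x`: a copy of the subtree at `x` if
the labels agree, and otherwise the node `y` rebuilt with the partition `(1, …, 1)`. -/
def restart (x ys : V) : Code V :=
  .nil fun null =>
  .ifNil ys (.ret null) <|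
  .head ys fun y =>
  .tail ys fun ys' =>
  .call .restart [x, ys'] fun zs =>
  .head x fun lx =>
  .head y fun ly =>
  .ifEq ly lx
    (.call .copy [x] fun z =>
     .cons z zs fun r =>
     .ret r)
    (.call .ones [ly] fun c =>
     .call .rebuildNode [ly, c] fun z =>
     .cons z zs fun r =>
     .ret r)

/-- From the new subtree `x`, go up along `path` to the root, restarting at each node of the path
the siblings after it. -/
def climb (x path : V) : Code V :=
  .ifNil path (.ret x) <|
  .head path fun entry =>
  .tail path fun path' =>
  .head entry fun m =>
  .tail entry fun sibs =>
  .head sibs fun before =>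
  .tail sibs fun after =>
  .call .restart [x, after] fun after' =>
  .cons x after' fun vs =>
  .call .revAppend [before, vs] fun vs' =>
  .cons m vs' fun parent =>
  .jump .climb [parent, path']

/-- The tree immediately next to the labeled ordered tree `t`, or null. -/
def nextTree (t : V) : Code V :=
  .nil fun null =>
  .call .findPivot [t, null] fun found =>
  .ifNil found (.ret null) <|
  .head found fun v =>
  .tail found fun path =>
  .head v fun m =>
  .tail v fun vs =>
  .call .inducedPartition [vs] fun a =>
  .call .nextPartition [a] fun b =>
  .call .rebuildNode [m, b] fun x =>
  .jump .climb [x, path]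

/-- The cotree of the subtree at `v` with root type `b` (`0` or `1`): a leaf becomes `nil`, and an
internal node a cell with its type and the list of its children. -/
def toCotree (b v : V) : Code V :=
  .num 1 fun one =>
  .nil fun null =>
  .tail v fun vs =>
  .ifNil vs (.ret null) <|
  .sub one b fun b' =>
  .call .toCotreeList [b', vs] fun cs =>
  .cons b cs fun r =>
  .ret r

/-- The cotrees, with root type `b`, of a list of subtrees. -/
def toCotreeList (b vs : V) : Code V :=
  .nil fun null =>
  .ifNil vs (.ret null) <|
  .head vs fun v =>
  .tail vs fun vs' =>
  .call .toCotree [b, v] fun c =>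
  .call .toCotreeList [b, vs'] fun cs =>
  .cons c cs fun r =>
  .ret r

/-- Output both cotrees of `t` and repeat with the next tree, until there is none. -/
def loop (t : V) : Code V :=
  .num 0 fun zero =>
  .num 1 fun one =>
  .call .toCotree [zero, t] fun c0 =>
  .output c0 <|
  .call .toCotree [one, t] fun c1 =>
  .output c1 <|
  .call .nextTree [t] fun t' =>
  .ifNil t' (.ret t') <|
  .jump .loop [t']

/-- Start from the minimum tree with `n` leaves, whose root induces the partition `(1, …, 1)`. -/
def cographGeneration (n : V) : Code V :=
  .call .ones [n] fun c =>
  .call .rebuildNode [n, c] fun t =>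
  .jump .loop [t]

/-- The bodies of the procedures. -/
def body : Proc → List V → Code V
  | .revAppend, [xs, ys] => revAppend xs ys
  | .sum, [xs, s] => sum xs s
  | .ones, [m] => ones m
  | .repeatPush, [q, x, ys] => repeatPush q x ys
  | .nextPartition, [a] => nextPartition a
  | .leafList, [m] => leafList m
  | .rebuildChildren, [a] => rebuildChildren a
  | .rebuildNode, [m, a] => rebuildNode m a
  | .inducedPartition, [vs] => inducedPartition vs
  | .findPivot, [v, path] => findPivot v path
  | .findPivotAmong, [m, rev, visited, path] => findPivotAmong m rev visited path
  | .copy, [v] => copy v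
  | .copyList, [vs] => copyList vs
  | .restart, [x, ys] => restart x ys
  | .climb, [x, path] => climb x path
  | .nextTree, [t] => nextTree t
  | .toCotree, [b, v] => toCotree b v
  | .toCotreeList, [b, vs] => toCotreeList b vs
  | .loop, [t] => loop t
  | .cographGeneration, [n] => cographGeneration n
  | _, _ => .nil fun null => .ret null

end Code

/-! ## Execution -/

/-- A state of the machine: the code that remains of the current procedure, the return stack, the
time elapsed, and the data output so far, in order, each with the time at which its output was
complete. -/
structure State where
  code : Code Val
  stack : List (Val → Code Val)
  time : ℕ
  log : List (ℕ × Val)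

namespace State

/-- One step of the machine. A return with an empty stack halts it. -/
def step : State → State
  | ⟨.ret x, [], t, w⟩ => ⟨.ret x, [], t, w⟩
  | ⟨.ret x, k :: ks, t, w⟩ => ⟨k x, ks, t + 1, w⟩
  | ⟨.num m k, ks, t, w⟩ => ⟨k (.num m), ks, t + 1, w⟩
  | ⟨.nil k, ks, t, w⟩ => ⟨k .nil, ks, t + 1, w⟩
  | ⟨.cons x y k, ks, t, w⟩ => ⟨k (.cons x y), ks, t + 1, w⟩
  | ⟨.head x k, ks, t, w⟩ => ⟨k x.head, ks, t + 1, w⟩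
  | ⟨.tail x k, ks, t, w⟩ => ⟨k x.tail, ks, t + 1, w⟩
  | ⟨.add x y k, ks, t, w⟩ => ⟨k (.num (x.toNat + y.toNat)), ks, t + 1, w⟩
  | ⟨.sub x y k, ks, t, w⟩ => ⟨k (.num (x.toNat - y.toNat)), ks, t + 1, w⟩
  | ⟨.div x y k, ks, t, w⟩ => ⟨k (.num (x.toNat / y.toNat)), ks, t + 1, w⟩
  | ⟨.mod x y k, ks, t, w⟩ => ⟨k (.num (x.toNat % y.toNat)), ks, t + 1, w⟩
  | ⟨.ifNil x p q, ks, t, w⟩ => ⟨if x.isNil then p else q, ks, t + 1, w⟩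
  | ⟨.ifEq x y p q, ks, t, w⟩ => ⟨if x.toNat = y.toNat then p else q, ks, t + 1, w⟩
  | ⟨.ifLe x y p q, ks, t, w⟩ => ⟨if x.toNat ≤ y.toNat then p else q, ks, t + 1, w⟩
  | ⟨.call f xs k, ks, t, w⟩ => ⟨Code.body f xs, k :: ks, t + 1, w⟩
  | ⟨.jump f xs, ks, t, w⟩ => ⟨Code.body f xs, ks, t + 1, w⟩
  | ⟨.output x p, ks, t, w⟩ => ⟨p, ks, t + x.size, w ++ [(t + x.size, x)]⟩

end State

/-- The run of `cographGeneration` on input `n` halts at time `τ`, and its outputs, each with the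
time at which it was complete, are those in the list `w`. -/
def Generates (n : ℕ) (w : List (ℕ × Val)) (τ : ℕ) : Prop :=
  ∃ (k : ℕ) (x : Val),
    State.step^[k] ⟨.jump .cographGeneration [.num n], [], 0, []⟩ = ⟨.ret x, [], τ, w⟩

namespace Cotree

mutual
/-- The datum by which the machine represents a cotree. -/
def toVal : Cotree → Val
  | leaf => .nil
  | node b cs => .cons (.num b.toNat) (toValList cs)
/-- The datum by which the machine represents a list of cotrees. -/
def toValList : List Cotree → Val
  | [] => .nil
  | c :: cs => .cons (toVal c) (toValList cs)
end

end Cotree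

-- Types are forgotten first: a `Shape` together with a root type determines a cotree, because types
-- alternate. The order in which the algorithm lists the trees is not defined separately; it is
-- reachability (`Shape.Reach`) under the deterministic map `Shape.next`. Siblings are compared by
-- number of leaves and then by reachability, and `Canon` singles out the trees whose children are
-- recursively sorted.
--
-- Completeness is `Shape.exists_endsAt`, by strong induction on the number m of leaves: one
-- sequence starts at `star m`, contains every canonical tree with m leaves, and ends. For a fixed
-- induced partition the lists of children run like an odometer from a least list to a last one
-- (`Shape.exists_last_list`); a restarted list is the least one compatible with the tree to its
-- left. The partitions themselves are linked by `Partition.reach_ones_and_greatest`. A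
-- deterministic sequence that ends never revisits a tree, so reachability is a linear order on the
-- canonical trees with m leaves, and sorting siblings gives each cotree a canonical representative
-- (`Shape.exists_canon`).
--
-- Outputs differ because the canonical shape can be recovered from the graph (`Shape.eq_of_iso`):
-- connectivity reveals the root type, complementation reduces to type 0, and then the components
-- are the graphs of the children. Cancelling components one at a time gives a permutation of the
-- children, and sorted lists that are permutations of each other are equal.
--
-- For the delay, a canonical tree with n leaves has fewer than 2n nodes (`Shape.Canon.nodes_lt`).
-- The search for the pivot visits each node at most once. The climb replaces pairwise disjoint
-- subtrees, each at a cost proportional to the number of its leaves (`Shape.red_restart`), so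
-- `Shape.red_nextTree` is linear; so are the conversion to cotrees and the size of an output.

/-! ## Partitions -/

namespace Partition

open Relation

/-- `IsPart p s a`: the list `a` is a non-decreasing partition of `s` into parts `≥ p`. -/
structure IsPart (p s : ℕ) (a : List ℕ) : Prop where
  ne_nil : a ≠ []
  sorted : a.Pairwise (· ≤ ·)
  le : ∀ x ∈ a, p ≤ x
  sum_eq : a.sum = s

/-- The lexicographically least partition of `s` into parts `≥ p`. -/
def least (p s : ℕ) : List ℕ := List.replicate (s / p - 1) p ++ [p + s % p]

/-- The lexicographically next partition, where partitions into one part are allowed. -/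
def next : List ℕ → List ℕ
  | [x, y] => if y - x ≤ 1 then [x + y] else least (x + 1) (x + y)
  | x :: y :: z :: r => x :: next (y :: z :: r)
  | a => a

/-- The lexicographically greatest partition of `m` with at least two parts. -/
def greatest (m : ℕ) : List ℕ := [m / 2, (m + 1) / 2]

/-- One application of `next` to a partition with at least two parts. -/
def Step (a b : List ℕ) : Prop := 2 ≤ a.length ∧ b = next a

/-- Determinism makes any two partitions reachable from a common one comparable. -/
theorem step_rightUnique : Relator.RightUnique Step := by
  rintro a b c ⟨-, rfl⟩ ⟨-, rfl⟩
  rfl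

theorem next_cons (x : ℕ) {a : List ℕ} (h : 2 ≤ a.length) : next (x :: a) = x :: next a := by
  match a, h with
  | y :: z :: r, _ => rfl

theorem next_append (f : List ℕ) (x y : ℕ) : next (f ++ [x, y]) = f ++ next [x, y] := by
  induction f with
  | nil => rfl
  | cons z f ih => rw [List.cons_append, next_cons _ (by simp), ih, List.cons_append]

theorem Step.cons (x : ℕ) {a b : List ℕ} (h : Step a b) : Step (x :: a) (x :: b) :=
  ⟨by have := h.1; simp; omega, by rw [next_cons _ h.1, h.2]⟩

theorem reach_cons (x : ℕ) {a b : List ℕ} (h : ReflTransGen Step a b) :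
    ReflTransGen Step (x :: a) (x :: b) :=
  h.lift (x :: ·) fun _ _ => Step.cons x

theorem isPart_singleton {p s : ℕ} (h : p ≤ s) : IsPart p s [s] :=
  ⟨by simp, by simp, by simpa using h, by simp⟩

theorem isPart_cons {p x s : ℕ} {a : List ℕ} (hp : p ≤ x) (h : IsPart x s a) :
    IsPart p (x + s) (x :: a) :=
  ⟨by simp, List.pairwise_cons.2 ⟨h.le, h.sorted⟩,
    by simpa [hp] using fun y hy => hp.trans (h.le y hy), by simp [h.sum_eq]⟩

theorem IsPart.tail {p s x : ℕ} {a : List ℕ} (h : IsPart p s (x :: a)) (ha : a ≠ []) :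
    p ≤ x ∧ ∃ s', s = x + s' ∧ IsPart x s' a :=
  ⟨h.le x (by simp), a.sum, by simpa using h.sum_eq.symm, ha,
    (List.pairwise_cons.1 h.sorted).2, (List.pairwise_cons.1 h.sorted).1, rfl⟩

theorem IsPart.le_sum {p s : ℕ} {a : List ℕ} (h : IsPart p s a) : p ≤ s := by
  match a, h.ne_nil with
  | x :: a, _ =>
    have h1 := h.le x (by simp)
    have h2 := h.sum_eq
    simp at h2
    omega

theorem IsPart.mono {p q s : ℕ} {a : List ℕ} (h : IsPart p s a) (hq : q ≤ p) : IsPart q s a :=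
  ⟨h.ne_nil, h.sorted, fun x hx => hq.trans (h.le x hx), h.sum_eq⟩

theorem IsPart.eq_singleton {p s x : ℕ} (h : IsPart p s [x]) : x = s := by
  simpa using h.sum_eq

theorem least_of_lt {p s : ℕ} (hp : p ≤ s) (h : s < 2 * p) : least p s = [s] := by
  have h1 : s / p = 1 := by
    rw [Nat.div_eq_iff (by omega)]; omega
  have h2 := Nat.div_add_mod s p
  rw [h1] at h2
  simp [least, h1]
  omega

/-- This recursion replaces the closed form with quotient and remainder in the inductions below. -/
theorem least_add {p s : ℕ} (h0 : 0 < p) (h : p ≤ s) : least p (p + s) = p :: least p s := by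
  have h1 : (p + s) / p = s / p + 1 := Nat.add_div_left s h0
  have h2 : 1 ≤ s / p := (Nat.one_le_div_iff h0).2 h
  obtain ⟨k, hk⟩ := Nat.exists_eq_add_of_le' h2
  simp [least, h1, hk, List.replicate_succ]

theorem isPart_least {p s : ℕ} (h0 : 0 < p) (h : p ≤ s) : IsPart p s (least p s) := by
  induction s using Nat.strong_induction_on with
  | _ s ih =>
    by_cases h2 : s < 2 * p
    · rw [least_of_lt h h2]
      exact isPart_singleton h
    · obtain ⟨t, rfl⟩ := Nat.exists_eq_add_of_le h
      rw [least_add h0 (by omega)]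
      exact isPart_cons le_rfl (ih t (by omega) (by omega))

theorem least_one (s : ℕ) (h : 1 ≤ s) : least 1 s = List.replicate s 1 := by
  obtain ⟨k, rfl⟩ := Nat.exists_eq_add_of_le' h
  simp [least, List.replicate_succ', Nat.mod_one]

/-- All partitions of `s` into parts `≥ p` lie between the least one and the one with one part. -/
theorem reach_least_and_singleton (s : ℕ) : ∀ (p : ℕ) (a : List ℕ), 0 < p → IsPart p s a →
    ReflTransGen Step (least p s) a ∧ ReflTransGen Step a [s] := by
  induction s using Nat.strong_induction_on with
  | _ s ih =>
    -- With the first part x held fixed, the tail runs from its least value to the single part t, by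
    -- induction on the sum.
    have up : ∀ x t, 0 < x → x ≤ t → s = x + t → ReflTransGen Step (least x s) [x, t] := by
      rintro x t hx hxt rfl
      rw [least_add hx hxt]
      exact reach_cons x (ih t (by omega) x _ hx (isPart_least hx hxt)).2
    have pair : ∀ x t, s = x + t → x + 2 ≤ t → Step [x, t] (least (x + 1) s) := by
      rintro x t rfl h
      refine ⟨by simp, ?_⟩
      rw [next, if_neg (by omega)]
    have pair' : ∀ x t, s = x + t → t < x + 2 → Step [x, t] [s] := by
      rintro x t rfl h
      refine ⟨by simp, ?_⟩
      rw [next, if_pos (by omega)]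
    -- Induction on s - x: the first part increases by one each time the walk leaves a two-part
    -- partition, until the two parts merge.
    have toTop : ∀ d x, s - x = d → 0 < x → x ≤ s → ReflTransGen Step (least x s) [s] := by
      intro d
      induction d using Nat.strong_induction_on with
      | _ d ihd =>
        intro x hd hx hxs
        by_cases h2 : s < 2 * x
        · rw [least_of_lt hxs h2]
        · obtain ⟨t, ht⟩ := Nat.exists_eq_add_of_le hxs
          refine (up x t hx (by omega) ht).trans ?_
          by_cases h3 : x + 2 ≤ t
          · exact .head (pair x t ht h3) (ihd _ (by omega) (x + 1) rfl (by omega) (by omega))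
          · exact .single (pair' x t ht (by omega))
    -- The bound 2x ≤ s guarantees that the two parts have not merged before the first part reaches
    -- x.
    have between : ∀ p x, 0 < p → p ≤ x → 2 * x ≤ s →
        ReflTransGen Step (least p s) (least x s) := by
      intro p x hp hpx
      induction x, hpx using Nat.le_induction with
      | base => exact fun _ => .refl
      | succ x hpx ihx =>
        intro h
        refine (ihx (by omega)).trans ?_
        exact (up x (s - x) (by omega) (by omega) (by omega)).tail
          (pair x (s - x) (by omega) (by omega))
    intro p a hp ha
    match a, ha with
    | [], ha => exact absurd rfl ha.ne_nil
    | [x], ha =>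
      obtain rfl := ha.eq_singleton
      exact ⟨toTop _ p rfl hp ha.le_sum, .refl⟩
    | x :: y :: r, ha =>
      obtain ⟨hpx, t, ht, hr⟩ := ha.tail (by simp)
      have hxt := hr.le_sum
      obtain ⟨h1, h2⟩ := ih t (by omega) x _ (by omega) hr
      constructor
      · refine (between p x hp hpx (by omega)).trans ?_
        rw [ht, least_add (by omega) hxt]
        exact reach_cons x h1
      · refine (reach_cons x h2).trans ?_
        by_cases h3 : x + 2 ≤ t
        · exact .head (pair x t ht h3) (toTop _ (x + 1) rfl (by omega) (by omega))
        · exact .single (pair' x t ht (by omega))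

theorem isPart_next {p s : ℕ} {a : List ℕ} (h0 : 0 < p) (h : IsPart p s a) :
    IsPart p s (next a) := by
  induction a generalizing p s with
  | nil => exact h
  | cons x a ih =>
    rcases a with - | ⟨y, - | ⟨z, r⟩⟩
    · exact h
    · obtain ⟨hpx, t, rfl, hr⟩ := h.tail (by simp)
      obtain rfl := hr.eq_singleton
      have := hr.le_sum
      simp only [next]
      split_ifs with h1
      · exact isPart_singleton (by omega)
      · exact (isPart_least (by omega) (by omega)).mono (by omega)
    · obtain ⟨hpx, t, rfl, hr⟩ := h.tail (by simp)
      exact isPart_cons hpx (ih (by omega) hr)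

theorem next_greatest {m : ℕ} : next (greatest m) = [m] := by
  rw [greatest, next, if_pos (by omega)]
  congr 1
  omega

/-- A two-part list merges into one part only if its parts differ by at most 1, which makes it the
greatest partition; a longer list keeps its first part. -/
theorem length_next {s : ℕ} {a : List ℕ} (h : IsPart 1 s a) (h2 : 2 ≤ a.length)
    (hg : a ≠ greatest s) : 2 ≤ (next a).length := by
  match a, h, h2, hg with
  | [x, y], h, _, hg =>
    obtain ⟨hpx, t, rfl, hr⟩ := h.tail (by simp)
    obtain rfl := hr.eq_singleton
    have hxy := hr.le_sum
    have h1 : ¬ (y - x ≤ 1) := by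
      intro h1
      apply hg
      simp only [greatest, List.cons.injEq, and_true]
      omega
    rw [next, if_neg h1]
    have : 1 < (x + y) / (x + 1) := (Nat.lt_div_iff_mul_lt (by omega)).2 (by omega)
    simp [least]
    omega
  | x :: y :: z :: r, h, _, hg =>
    rw [next, List.length_cons]
    obtain ⟨hpx, t, rfl, hr⟩ := h.tail (by simp)
    have := List.length_pos_of_ne_nil (isPart_next (by omega) hr).ne_nil
    omega

/-- A step that starts from a partition other than the greatest one. -/
def ProperStep (a b : List ℕ) : Prop := Step a b ∧ a ≠ greatest a.sum

/-- The greatest partition steps to the one-part list, from which no step leaves, so a walk to a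
partition with at least two parts never steps from the greatest one. -/
theorem reach_proper {s : ℕ} {a b : List ℕ} (h : ReflTransGen Step a b) (ha : IsPart 1 s a)
    (hb : 2 ≤ b.length) : ReflTransGen ProperStep a b := by
  induction h using ReflTransGen.head_induction_on with
  | refl => exact .refl
  | @head a c hac hcb ih =>
    have hc : c = next a := hac.2
    refine .head ⟨hac, fun hg => ?_⟩ (ih (hc ▸ isPart_next one_pos ha))
    rw [hg, next_greatest] at hc
    subst hc
    rcases hcb.cases_head with rfl | ⟨_, ⟨h, -⟩, -⟩
    · simp at hb
    · simp at h

theorem isPart_greatest {m : ℕ} (hm : 2 ≤ m) : IsPart 1 m (greatest m) := by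
  have h : m = m / 2 + (m + 1) / 2 := by omega
  conv => enter [2]; rw [h]
  exact isPart_cons (by omega) (isPart_singleton (by omega))

/-- All partitions of `m` with at least two parts lie between the least and the greatest one. -/
theorem reach_ones_and_greatest {m : ℕ} {a : List ℕ} (ha : IsPart 1 m a) (h2 : 2 ≤ a.length) :
    ReflTransGen ProperStep (List.replicate m 1) a ∧ ReflTransGen ProperStep a (greatest m) := by
  have hm : 2 ≤ m := by
    match a, ha, h2 with
    | x :: y :: r, ha, _ =>
      have := ha.sum_eq
      have := ha.le x (by simp)
      have := ha.le y (by simp)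
      simp at *
      omega
  have h1 := (reach_least_and_singleton m 1 a one_pos ha).1
  have hg := (reach_least_and_singleton m 1 _ one_pos (isPart_greatest hm)).1
  have hl := isPart_least (p := 1) (s := m) one_pos (by omega)
  rw [least_one m (by omega)] at h1 hg hl
  refine ⟨reach_proper h1 hl h2, ?_⟩
  -- Both partitions are reachable from the least one, hence comparable. Beyond the greatest one
  -- there is only the one-part list, which excludes the wrong order.
  rcases ReflTransGen.total_of_right_unique step_rightUnique h1 hg with h | h
  · exact reach_proper h ha (by simp [greatest])
  · rcases h.cases_head with rfl | ⟨c, ⟨-, rfl⟩, hc⟩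
    · exact .refl
    · rw [next_greatest] at hc
      rcases hc.cases_head with rfl | ⟨_, ⟨h, -⟩, -⟩
      · simp at h2
      · simp at h

end Partition

/-! ## Shapes: cotrees without types -/

/-- Plane rooted trees. -/
inductive Shape : Type
  | leaf : Shape
  | node (children : List Shape) : Shape

namespace Shape

open Relation

theorem induction {P : Shape → Prop} (leaf : P leaf)
    (node : ∀ cs, (∀ c ∈ cs, P c) → P (node cs)) (t : Shape) : P t :=
  Shape.rec (motive_1 := P) (motive_2 := fun cs => ∀ c ∈ cs, P c) leaf node (by simp)
    (fun _ _ h hs => by simpa using ⟨h, hs⟩) t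

mutual
/-- The number of leaves. -/
def leaves : Shape → ℕ
  | leaf => 1
  | node cs => leavesList cs
/-- The total number of leaves of a list of shapes. -/
def leavesList : List Shape → ℕ
  | [] => 0
  | c :: cs => leaves c + leavesList cs
end

/-- The partition induced by a node with the given children. -/
def sizes (cs : List Shape) : List ℕ := cs.map leaves

theorem leavesList_eq (cs : List Shape) : leavesList cs = (sizes cs).sum := by
  induction cs with
  | nil => rfl
  | cons c cs ih => simp [leavesList, sizes, ih]

/-- The tree with `m` leaves whose root induces the partition `(1, …, 1)`. -/
def star (m : ℕ) : Shape := if m ≤ 1 then leaf else node (List.replicate m leaf)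

theorem leaves_star {m : ℕ} (hm : 1 ≤ m) : (star m).leaves = m := by
  unfold star
  split_ifs with h
  · simp [leaves]; omega
  · simp [leaves, leavesList_eq, sizes]

/-- The trees that replace the siblings, with numbers of leaves `a`, after the node `x`. -/
def restart (x : Shape) (a : List ℕ) : List Shape :=
  a.map fun m => if m = x.leaves then x else star m

mutual
/-- The next tree. -/
def next : Shape → Option Shape
  | leaf => none
  | node cs =>
    match nextList cs with
    | some cs' => some (node cs')
    | none =>
      if sizes cs = Partition.greatest (sizes cs).sum then none
      else some (node ((Partition.next (sizes cs)).map star))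
/-- Replace, in a list of siblings, the last one that has a next tree, and restart those after
it. -/
def nextList : List Shape → Option (List Shape)
  | [] => none
  | c :: cs =>
    match nextList cs with
    | some cs' => some (c :: cs')
    | none =>
      match next c with
      | some c' => some (c' :: restart c' (sizes cs))
      | none => none
end

-- Reachability as an order on trees

/-- `Reach s t`: the tree `t` occurs in the sequence of trees that starts with `s`. -/
abbrev Reach : Shape → Shape → Prop := ReflTransGen fun s t => next s = some t

/-- The same for lists of siblings. -/
abbrev ReachList : List Shape → List Shape → Prop := ReflTransGen fun s t => nextList s = some t

theorem rightUnique_next : Relator.RightUnique fun s t : Shape => next s = some t := by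
  intro a b c hb hc
  simpa [hb] using hc

theorem reach_total {s t u : Shape} (ht : Reach s t) (hu : Reach s u) : Reach t u ∨ Reach u t :=
  ReflTransGen.total_of_right_unique rightUnique_next ht hu

/-- A sequence that ends does not come back to any of its trees. -/
theorem not_reach_next {s t M : Shape} (hM : next M = none) (h : Reach s M)
    (hst : next s = some t) : ¬ Reach t s := by
  induction h using ReflTransGen.head_induction_on generalizing t with
  | refl => simp [hM] at hst
  | @head s u hsu _ ih =>
    obtain rfl : u = t := by simpa [hsu] using hst
    intro hus
    -- A cycle through s also passes through its successor, which is closer to the end M.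
    rcases hus.cases_head with rfl | ⟨v, huv, hv⟩
    · exact ih hsu .refl
    · exact ih huv (hv.tail hsu)

theorem reach_antisymm {s t M : Shape} (hM : next M = none) (hs : Reach s M)
    (hst : Reach s t) (hts : Reach t s) : s = t := by
  rcases hst.cases_head with rfl | ⟨u, hsu, hut⟩
  · rfl
  · exact absurd (hut.trans hts) (not_reach_next hM hs hsu)

theorem reach_node {cs ds : List Shape} (h : ReachList cs ds) : Reach (node cs) (node ds) :=
  h.lift node fun a b hab => by
    change next (node a) = _
    rw [next, hab]

theorem reachList_cons (c : Shape) {cs ds : List Shape} (h : ReachList cs ds) :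
    ReachList (c :: cs) (c :: ds) :=
  h.lift (c :: ·) fun a b hab => by
    change nextList (c :: a) = _
    rw [nextList, hab]

theorem nextList_append (us : List Shape) {cs ds : List Shape} (h : nextList cs = some ds) :
    nextList (us ++ cs) = some (us ++ ds) := by
  induction us with
  | nil => exact h
  | cons u us ih => rw [List.cons_append, nextList, ih, List.cons_append]

/-- The order in which siblings are listed. -/
def SibLE (x y : Shape) : Prop := x.leaves < y.leaves ∨ x.leaves = y.leaves ∧ Reach x y

theorem SibLE.refl (x : Shape) : SibLE x x := .inr ⟨rfl, .refl⟩

theorem SibLE.trans {x y z : Shape} (h : SibLE x y) (h' : SibLE y z) : SibLE x z := by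
  rcases h with h | ⟨h, r⟩ <;> rcases h' with h' | ⟨h', r'⟩
  · exact .inl (h.trans h')
  · exact .inl (h' ▸ h)
  · exact .inl (h ▸ h')
  · exact .inr ⟨h.trans h', r.trans r'⟩

theorem SibLE.leaves_le {x y : Shape} (h : SibLE x y) : x.leaves ≤ y.leaves := by
  rcases h with h | ⟨h, -⟩
  · exact h.le
  · exact h.le

/-- The representatives of the trees up to sibling permutations: every internal node has at least
two children, and these are listed in the order `SibLE`. -/
inductive Canon : Shape → Prop
  | leaf : Canon leaf
  | node (cs : List Shape) (two_le : 2 ≤ cs.length) (canon : ∀ c ∈ cs, Canon c)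
      (sorted : cs.Pairwise SibLE) : Canon (node cs)

theorem Canon.leaves_pos {t : Shape} (h : Canon t) : 1 ≤ t.leaves := by
  induction h with
  | leaf => simp [leaves]
  | node cs two_le _ _ ih =>
    match cs, two_le with
    | c :: cs, _ =>
      have := ih c (by simp)
      simp [leaves, leavesList]
      omega

theorem Canon.two_le_leaves {cs : List Shape} (h : Canon (.node cs)) :
    2 ≤ (Shape.node cs).leaves := by
  cases h with
  | node _ two_le canon _ =>
    match cs, two_le with
    | c :: d :: cs, _ =>
      have := (canon c (by simp)).leaves_pos
      have := (canon d (by simp)).leaves_pos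
      simp [leaves, leavesList]
      omega

theorem sizes_sorted {cs : List Shape} (h : cs.Pairwise SibLE) :
    (sizes cs).Pairwise (· ≤ ·) :=
  List.pairwise_map.2 (h.imp SibLE.leaves_le)

theorem isPart_sizes {cs : List Shape} (h0 : cs ≠ []) (hc : ∀ c ∈ cs, Canon c)
    (hs : cs.Pairwise SibLE) : Partition.IsPart 1 (sizes cs).sum (sizes cs) :=
  ⟨by simpa [sizes] using h0, sizes_sorted hs, by
    simpa [sizes] using fun c h => (hc c h).leaves_pos, rfl⟩

theorem sizes_map_star {a : List ℕ} (h : ∀ x ∈ a, 1 ≤ x) : sizes (a.map star) = a := by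
  rw [sizes, List.map_map]
  conv => rhs; rw [← List.map_id a]
  exact List.map_congr_left fun x hx => leaves_star (h x hx)

theorem sizes_restart (x : Shape) {a : List ℕ} (h : ∀ m ∈ a, 1 ≤ m) :
    sizes (restart x a) = a := by
  rw [sizes, restart, List.map_map]
  conv => rhs; rw [← List.map_id a]
  refine List.map_congr_left fun m hm => ?_
  by_cases hx : m = x.leaves
  · simp [hx]
  · simp [hx, leaves_star (h m hm)]

/-- Copying a star and rebuilding a star of the same size agree. Hence the children of a rebuilt
node form a restarted list, and the statements on restarted lists apply to them. -/
theorem restart_star {m : ℕ} (hm : 1 ≤ m) (a : List ℕ) : restart (star m) a = a.map star := by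
  rw [restart]
  refine List.map_congr_left fun k _ => ?_
  rw [leaves_star hm]
  split_ifs with h
  · rw [h]
  · rfl

theorem canon_star (m : ℕ) : Canon (star m) := by
  unfold star
  split_ifs with h
  · exact .leaf
  · refine .node _ (by simp; omega) (fun c hc => ?_) ?_
    · rw [List.eq_of_mem_replicate hc]; exact .leaf
    · exact List.pairwise_replicate.2 (.inr (SibLE.refl _))

theorem sibLE_star {m k : ℕ} (hm : 1 ≤ m) (h : m ≤ k) : SibLE (star m) (star k) := by
  rcases h.lt_or_eq with h | rfl
  · left
    rwa [leaves_star hm, leaves_star (by omega)]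
  · exact SibLE.refl _

theorem canon_map_star {s : ℕ} {a : List ℕ} (h : Partition.IsPart 1 s a) (h2 : 2 ≤ a.length) :
    Canon (node (a.map star)) := by
  refine .node _ (by simpa using h2) (fun c hc => ?_) ?_
  · obtain ⟨m, -, rfl⟩ := List.mem_map.1 hc
    exact canon_star m
  · exact List.pairwise_map.2 (h.sorted.imp_of_mem fun ha _ hab => sibLE_star (h.le _ ha) hab)

theorem sibLE_of_mem_restart {x y : Shape} {a : List ℕ} (h1 : ∀ m ∈ a, 1 ≤ m)
    (ha : ∀ m ∈ a, x.leaves ≤ m)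
    (hy : y ∈ restart x a) : SibLE x y := by
  obtain ⟨m, hm, rfl⟩ := List.mem_map.1 hy
  split_ifs with h
  · exact SibLE.refl x
  · left
    rw [leaves_star (h1 m hm)]
    exact lt_of_le_of_ne (ha m hm) (Ne.symm h)

theorem canon_of_mem_restart {x y : Shape} {a : List ℕ} (hx : Canon x) (hy : y ∈ restart x a) :
    Canon y := by
  obtain ⟨m, hm, rfl⟩ := List.mem_map.1 hy
  split_ifs with h
  · exact hx
  · exact canon_star m

/-- Restarting after x or after the first replaced sibling gives the same tail: once a size exceeds
that of x, all later sizes do, and only stars follow. -/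
theorem restart_cons {x : Shape} {m : ℕ} {a : List ℕ} (hm : 1 ≤ m) (hx : x.leaves ≤ m)
    (ha : ∀ k ∈ a, m ≤ k) :
    restart x (m :: a) = (if m = x.leaves then x else star m) ::
      restart (if m = x.leaves then x else star m) a := by
  rw [restart, List.map_cons]
  split_ifs with h
  · rfl
  · rw [restart_star hm, List.map_congr_left fun k hk => ?_]
    have := ha k hk
    rw [if_neg (by omega)]

theorem sorted_restart {x : Shape} {a : List ℕ} (h1 : ∀ m ∈ a, 1 ≤ m)
    (hs : a.Pairwise (· ≤ ·)) (ha : ∀ m ∈ a, x.leaves ≤ m) : (restart x a).Pairwise SibLE := by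
  induction a generalizing x with
  | nil => exact .nil
  | cons m a ih =>
    simp only [List.mem_cons, forall_eq_or_imp, List.pairwise_cons] at h1 hs ha
    rw [restart_cons h1.1 ha.1 hs.1]
    have hl : (if m = x.leaves then x else star m).leaves = m := by
      split_ifs with h
      · exact h.symm
      · exact leaves_star h1.1
    have hl' := fun k hk => hl.trans_le (hs.1 k hk)
    exact List.pairwise_cons.2 ⟨fun y hy => sibLE_of_mem_restart h1.2 hl' hy,
      ih h1.2 hs.2 hl'⟩

-- Invariance of canonical trees

mutual
theorem next_spec {t t' : Shape} (ht : Canon t) (h : next t = some t') :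
    Canon t' ∧ t'.leaves = t.leaves := by
  match t, ht, h with
  | leaf, _, h => simp [next] at h
  | node cs, .node _ two_le canon sorted, h =>
    rw [next] at h
    rcases hn : nextList cs with - | cs'
    · rw [hn] at h
      simp only [Option.ite_none_left_eq_some, Option.some.injEq] at h
      obtain ⟨hg, rfl⟩ := h
      have hp := isPart_sizes (by rintro rfl; simp at two_le) canon sorted
      have hp' := Partition.isPart_next one_pos hp
      have h2 := Partition.length_next hp (by simpa [sizes] using two_le) hg
      refine ⟨canon_map_star hp' h2, ?_⟩
      rw [leaves, leaves, leavesList_eq, leavesList_eq, sizes_map_star hp'.le, hp'.sum_eq]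
    · rw [hn] at h
      obtain rfl : node cs' = t' := by simpa using h
      obtain ⟨h1, h2, h3, -⟩ := nextList_spec canon sorted hn
      refine ⟨.node _ ?_ h1 h2, ?_⟩
      · have := congrArg List.length h3
        simp only [sizes, List.length_map] at this
        omega
      · rw [leaves, leaves, leavesList_eq, leavesList_eq, h3]
-- The last clause keeps the list sorted when an unchanged sibling is put back in front of a changed
-- tail.
theorem nextList_spec {cs cs' : List Shape} (hc : ∀ c ∈ cs, Canon c) (hs : cs.Pairwise SibLE)
    (h : nextList cs = some cs') : (∀ c ∈ cs', Canon c) ∧ cs'.Pairwise SibLE ∧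
      sizes cs' = sizes cs ∧ ∀ x, (∀ c ∈ cs, SibLE x c) → ∀ c ∈ cs', SibLE x c := by
  match cs, hc, hs, h with
  | [], _, _, h => simp [nextList] at h
  | c :: cs, hc, hs, h =>
    simp only [List.mem_cons, forall_eq_or_imp, List.pairwise_cons] at hc hs
    rw [nextList] at h
    rcases hn : nextList cs with - | ds
    · rw [hn] at h
      rcases hd : next c with - | c'
      · simp [hd] at h
      · obtain rfl : c' :: restart c' (sizes cs) = cs' := by simpa [hd] using h
        obtain ⟨h1, h2⟩ := next_spec hc.1 hd
        have hpos : ∀ m ∈ sizes cs, 1 ≤ m := by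
          simpa [sizes] using fun c h => (hc.2 c h).leaves_pos
        have hle : ∀ m ∈ sizes cs, c'.leaves ≤ m := by
          simpa [sizes, h2] using fun c h => (hs.1 c h).leaves_le
        refine ⟨?_, ?_, ?_, ?_⟩
        · simpa using ⟨h1, fun y hy => canon_of_mem_restart h1 hy⟩
        · exact List.pairwise_cons.2 ⟨fun y hy => sibLE_of_mem_restart hpos hle hy,
            sorted_restart hpos (sizes_sorted hs.2) hle⟩
        · have := sizes_restart c' hpos
          simp only [sizes, List.map_cons] at this ⊢
          rw [this, h2]
        · intro x hx
          have hx' : SibLE x c' := by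
            refine (hx c (by simp)).trans (.inr ⟨h2.symm, .single hd⟩)
          simpa using ⟨hx', fun y hy => hx'.trans (sibLE_of_mem_restart hpos hle hy)⟩
    · rw [hn] at h
      obtain rfl : c :: ds = cs' := by simpa using h
      obtain ⟨h1, h2, h3, h4⟩ := nextList_spec hc.2 hs.2 hn
      refine ⟨by simpa using ⟨hc.1, h1⟩, List.pairwise_cons.2 ⟨h4 c hs.1, h2⟩, ?_, ?_⟩
      · simpa [sizes] using h3
      · intro x hx
        simp only [List.mem_cons, forall_eq_or_imp] at hx
        simpa using ⟨hx.1, h4 x hx.2⟩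
end

-- The sequence of next trees is exhaustive

theorem Reach.spec {s t : Shape} (h : Reach s t) (hs : Canon s) :
    Canon t ∧ t.leaves = s.leaves := by
  induction h with
  | refl => exact ⟨hs, rfl⟩
  | tail _ h ih =>
    obtain ⟨h1, h2⟩ := next_spec ih.1 h
    exact ⟨h1, h2.trans ih.2⟩

/-- The sequence that starts with `star m` contains all trees with `m` leaves and ends with `M`. -/
def EndsAt (m : ℕ) (M : Shape) : Prop :=
  Canon M ∧ M.leaves = m ∧ next M = none ∧
    ∀ t, Canon t → t.leaves = m → Reach (star m) t ∧ Reach t M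

/-- Going through all trees at a node `x` before given siblings. -/
theorem reachList_of_reach {x y : Shape} {a : List ℕ} {F : List Shape} (hF : nextList F = none)
    (hFa : sizes F = a) (h : Reach x y) (hx : ∀ z, Reach x z → ReachList (restart z a) F) :
    ReachList (x :: restart x a) (y :: restart y a) := by
  induction h with
  | refl => exact .refl
  | @tail y z hxy hyz ih =>
    -- The tail after y runs through to the last list F; only then does y itself advance, and the
    -- tail restarts.
    refine (ih.trans (reachList_cons y (hx y hxy))).tail ?_
    rw [nextList, hF, hyz, hFa]

/-- All lists of siblings with given numbers of leaves lie between the least and the last one. -/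
theorem exists_last_list (a : List ℕ) (h1 : ∀ m ∈ a, 1 ≤ m) (hs : a.Pairwise (· ≤ ·))
    (ih : ∀ m ∈ a, ∃ M, EndsAt m M) :
    ∃ F, sizes F = a ∧ nextList F = none ∧ (∀ c ∈ F, Canon c) ∧
      (∀ x, Canon x → (∀ m ∈ a, x.leaves ≤ m) → ReachList (restart x a) F) ∧
      ∀ cs, (∀ c ∈ cs, Canon c) → cs.Pairwise SibLE → sizes cs = a → ReachList cs F ∧
        ∀ x, Canon x → (∀ c ∈ cs, SibLE x c) → ReachList (restart x a) cs := by
  induction a with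
  | nil =>
    refine ⟨[], rfl, rfl, by simp, fun x _ _ => .refl, fun cs _ _ h => ?_⟩
    obtain rfl : cs = [] := by simpa [sizes] using h
    exact ⟨.refl, fun x _ _ => .refl⟩
  | cons m a iha =>
    simp only [List.mem_cons, forall_eq_or_imp, List.pairwise_cons] at h1 hs ih
    obtain ⟨F, hFa, hF, hFc, hmin, hall⟩ := iha h1.2 hs.2 ih.2
    obtain ⟨M, hMc, hMm, hM, hMall⟩ := ih.1
    have walk : ∀ x y, Canon x → x.leaves = m → Reach x y →
        ReachList (x :: restart x a) (y :: restart y a) := by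
      intro x y hx hxm hxy
      refine reachList_of_reach hF hFa hxy fun z hz => hmin z (hz.spec hx).1 fun k hk => ?_
      rw [(hz.spec hx).2, hxm]
      exact hs.1 k hk
    have top : ∀ x, Canon x → x.leaves = m → ReachList (x :: restart x a) (M :: F) := by
      intro x hx hxm
      refine (walk x M hx hxm (hMall x hx hxm).2).trans (reachList_cons M (hmin M hMc ?_))
      rw [hMm]
      exact hs.1
    -- The least tree with m leaves that may follow x: x itself if the sizes agree, and otherwise
    -- the star.
    have first : ∀ x : Shape, Canon x → Canon (if m = x.leaves then x else star m) ∧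
        (if m = x.leaves then x else star m).leaves = m := by
      intro x hx
      split_ifs with h
      · exact ⟨hx, h.symm⟩
      · exact ⟨canon_star m, leaves_star h1.1⟩
    refine ⟨M :: F, by simpa [sizes, hMm] using hFa, by simp [nextList, hF, hM],
      by simpa using ⟨hMc, hFc⟩, fun x hx hxa => ?_, ?_⟩
    · rw [restart_cons h1.1 (hxa m (by simp)) hs.1]
      exact top _ (first x hx).1 (first x hx).2
    · rintro (- | ⟨d, ds⟩) hc hp hd
      · simp [sizes] at hd
      · simp only [List.mem_cons, forall_eq_or_imp, List.pairwise_cons] at hc hp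
        obtain ⟨hdm, hda⟩ : d.leaves = m ∧ sizes ds = a := by simpa [sizes] using hd
        obtain ⟨hds, hds'⟩ := hall ds hc.2 hp.2 hda
        constructor
        · refine (reachList_cons d hds).trans ?_
          -- When the tail is at its last list F, either d is already the last tree M, or d advances
          -- and the rest of the walk is `top`.
          rcases (hMall d hc.1 hdm).2.cases_head with rfl | ⟨d', hd', -⟩
          · exact .refl
          · obtain ⟨hd1, hd2⟩ := next_spec hc.1 hd'
            refine .head ?_ (top d' hd1 (hd2.trans hdm))
            rw [nextList, hF, hd', hFa]
        · intro x hx hxd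
          have hxd1 := hxd d (by simp)
          rw [restart_cons h1.1 (hdm ▸ hxd1.leaves_le) hs.1]
          obtain ⟨hf1, hf2⟩ := first x hx
          refine (walk _ d hf1 hf2 ?_).trans (reachList_cons d (hds' d hc.1 hp.1))
          split_ifs with h
          · rcases hxd1 with h' | ⟨-, h'⟩
            · omega
            · exact h'
          · exact (hMall d hc.1 hdm).1

/-- The trees whose root induces a fixed partition form a block from its list of stars to its last
list. From the end of a block the sequence passes to the list of stars of the next partition. The
first block belongs to (1, …, 1), the final one to the greatest partition. -/
theorem exists_endsAt (m : ℕ) (hm : 1 ≤ m) : ∃ M, EndsAt m M := by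
  induction m using Nat.strong_induction_on with
  | _ m ih =>
    by_cases hm1 : m = 1
    · subst hm1
      refine ⟨leaf, .leaf, rfl, rfl, fun t ht h1 => ?_⟩
      cases t with
      | leaf => exact ⟨.refl, .refl⟩
      | node cs =>
        have := ht.two_le_leaves
        omega
    have hm2 : 2 ≤ m := by omega
    -- With at least two positive parts, every part is smaller than m.
    have smaller : ∀ a, Partition.IsPart 1 m a → 2 ≤ a.length → ∀ k ∈ a, ∃ M, EndsAt k M := by
      intro a ha h2 k hk
      refine ih k ?_ (ha.le k hk)
      match a, ha, h2, hk with
      | x :: y :: r, ha, _, hk =>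
        have e := ha.sum_eq
        simp at e hk
        have := ha.le x (by simp)
        have := ha.le y (by simp)
        rcases hk with rfl | rfl | hk
        · omega
        · omega
        · have := List.single_le_sum (by simp) k hk
          omega
    have last := fun a (ha : Partition.IsPart 1 m a) (h2 : 2 ≤ a.length) =>
      exists_last_list a ha.le ha.sorted (smaller a ha h2)
    have stars : ∀ a, Partition.IsPart 1 m a → ∃ k ∈ a, 1 ≤ k ∧ (∀ j ∈ a, k ≤ j) ∧
        a.map star = restart (star k) a := by
      intro a ha
      match a, ha with
      | k :: r, ha =>
        have hk := ha.le k (by simp)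
        exact ⟨k, by simp, hk, by simpa using (List.pairwise_cons.1 ha.sorted).1,
          (restart_star hk _).symm⟩
      | [], ha => exact absurd rfl ha.ne_nil
    have climb : ∀ a b, Partition.IsPart 1 m a → 2 ≤ a.length →
        ReflTransGen Partition.ProperStep a b → Reach (node (a.map star)) (node (b.map star)) := by
      intro a b ha h2 hab
      induction hab using ReflTransGen.head_induction_on with
      | refl => exact .refl
      | @head a c hac hcb ih' =>
        obtain ⟨⟨-, rfl⟩, hg⟩ := hac
        rw [ha.sum_eq] at hg
        refine .trans ?_ (ih' (Partition.isPart_next one_pos ha) (Partition.length_next ha h2 hg))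
        obtain ⟨F, hFa, hF, -, hmin, -⟩ := last a ha h2
        obtain ⟨k, hk, hk1, hka, hks⟩ := stars a ha
        rw [hks]
        refine (reach_node (hmin (star k) (canon_star k) (by rwa [leaves_star hk1]))).tail ?_
        rw [next, hF, hFa, ha.sum_eq]
        simp [hg]
    have starm : star m = node ((List.replicate m 1).map star) := by
      rw [star, if_neg (by omega)]
      simp [star]
    have hg := Partition.isPart_greatest hm2
    obtain ⟨G, hGa, hG, hGc, hGmin, hGall⟩ := last _ hg (by simp [Partition.greatest])
    have main : ∀ t, Canon t → t.leaves = m → Reach (star m) t ∧ Reach t (node G) := by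
      intro t ht htm
      cases ht with
      | leaf => exact absurd htm.symm hm1
      | node cs two_le canon sorted =>
        have hp := isPart_sizes (by rintro rfl; simp at two_le) canon sorted
        rw [leaves, leavesList_eq] at htm
        rw [htm] at hp
        have h2 : 2 ≤ (sizes cs).length := by simpa [sizes] using two_le
        obtain ⟨F, hFa, hF, -, hmin, hall⟩ := last _ hp h2
        obtain ⟨h3, h4⟩ := Partition.reach_ones_and_greatest hp h2
        obtain ⟨h5, h6⟩ := hall cs canon sorted rfl
        obtain ⟨k, hk, hk1, hka, hks⟩ := stars _ hp
        constructor
        · rw [starm]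
          refine (climb _ _ ?_ (by simpa using hm2) h3).trans ?_
          · rw [← Partition.least_one m hm]
            exact Partition.isPart_least one_pos hm
          · rw [hks]
            refine reach_node (h6 _ (canon_star k) fun c hc => ?_)
            have hck : k ≤ c.leaves := hka _ (List.mem_map_of_mem hc)
            rcases hck.lt_or_eq with hlt | heq
            · left
              rwa [leaves_star hk1]
            · right
              obtain ⟨M, -, -, -, hM⟩ := smaller _ hp h2 k hk
              exact ⟨by rw [leaves_star hk1, heq], (hM c (canon c hc) heq.symm).1⟩
        · refine (reach_node h5).trans ?_
          -- In the final block F and G are both reachable from `cs`, hence comparable, and G has no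
          -- successor. In any other block the walk goes on to the greatest partition.
          by_cases hgr : sizes cs = Partition.greatest m
          · have := hGall cs canon sorted hgr
            rcases ReflTransGen.total_of_right_unique (r := fun s t => nextList s = some t)
              (fun a b c hb hc => by simpa [hb] using hc) h5 this.1 with h | h
            · exact reach_node h
            · rcases h.cases_head with rfl | ⟨_, h, -⟩
              · exact .refl
              · simp [hG] at h
          · refine .head (b := node ((Partition.next (sizes cs)).map star)) ?_ ?_
            · rw [next, hF, hFa, htm]
              simp [hgr]
            · have hn := Partition.isPart_next one_pos hp
              have hl := Partition.length_next hp h2 hgr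
              obtain ⟨k, hk, hk1, hka, hks⟩ := stars _ hg
              refine (climb _ _ hn hl (Partition.reach_ones_and_greatest hn hl).2).trans ?_
              rw [hks]
              exact reach_node (hGmin _ (canon_star k) (by rwa [leaves_star hk1]))
    refine ⟨node G, ?_, ?_, ?_, main⟩
    · have := (main (star m) (canon_star m) (leaves_star hm)).2
      exact (this.spec (canon_star m)).1
    · rw [leaves, leavesList_eq, hGa, hg.sum_eq]
    · rw [next, hG, hGa, hg.sum_eq]
      simp

end Shape

/-! ## Disjoint unions, joins and complements -/

namespace SimpleGraph

variable {V W V' W' : Type*}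

/-- Isomorphic graphs have isomorphic complements. -/
def Iso.complCongr {G : SimpleGraph V} {H : SimpleGraph W} (e : G ≃g H) : Gᶜ ≃g Hᶜ where
  toEquiv := e.toEquiv
  map_rel_iff' := by
    intro a b
    have h1 : H.Adj (e.toEquiv a) (e.toEquiv b) ↔ G.Adj a b := e.map_rel_iff'
    simpa [SimpleGraph.compl_adj] using fun _ => not_congr h1

/-- De Morgan's law: statements on joins follow from those on disjoint unions and complements. -/
theorem graphJoin_eq (G : SimpleGraph V) (H : SimpleGraph W) :
    graphJoin G H = (Gᶜ ⊕g Hᶜ)ᶜ := by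
  ext (a | a) (b | b) <;> simp [graphJoin, SimpleGraph.sum, completeBipartiteGraph]
  · exact ⟨fun h => ⟨h.ne, fun _ => h⟩, fun h => h.2 h.1⟩
  · exact ⟨fun h => ⟨h.ne, fun _ => h⟩, fun h => h.2 h.1⟩

/-- The join of isomorphic graphs. -/
def Iso.joinCongr {G : SimpleGraph V} {H : SimpleGraph W} {G' : SimpleGraph V'}
    {H' : SimpleGraph W'} (e : G ≃g G') (f : H ≃g H') : graphJoin G H ≃g graphJoin G' H' := by
  rw [graphJoin_eq, graphJoin_eq]
  exact (Iso.sumCongr e.complCongr f.complCongr).complCongr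

/-- The disjoint union with an empty graph. -/
def Iso.sumEmpty [IsEmpty W] (G : SimpleGraph V) (H : SimpleGraph W) : G ⊕g H ≃g G where
  toEquiv := Equiv.sumEmpty V W
  map_rel_iff' := by
    rintro (a | a) (b | b)
    · simp [SimpleGraph.sum]
    all_goals exact isEmptyElim ‹W›

/-- The join with an empty graph. -/
def Iso.joinEmpty [IsEmpty W] (G : SimpleGraph V) (H : SimpleGraph W) : graphJoin G H ≃g G := by
  rw [graphJoin_eq]
  exact (Iso.sumEmpty Gᶜ Hᶜ).complCongr.trans (by rw [compl_compl])

/-- Exchanging the first two of three summands. -/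
def Iso.sumLeftComm {U : Type*} (F : SimpleGraph U) (G : SimpleGraph V) (H : SimpleGraph W) :
    F ⊕g (G ⊕g H) ≃g G ⊕g (F ⊕g H) :=
  (Iso.sumAssoc.symm.trans (Iso.sumCongr Iso.sumComm Iso.refl)).trans Iso.sumAssoc

/-- A connected summand is a whole component. This describes the side of a vertex in terms that
isomorphisms preserve. -/
theorem reachable_sum_inl_iff {G : SimpleGraph V} {H : SimpleGraph W} (hG : G.Preconnected)
    (v : V) (x : V ⊕ W) : (G ⊕g H).Reachable (.inl v) x ↔ x.isLeft := by
  constructor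
  · rcases x with x | x
    · simp
    · exact fun h => absurd h (not_reachable_sum_inl_inr v x)
  · rcases x with x | x
    · exact fun _ => (hG v x).map (Embedding.sumInl (G := G) (H := H)).toHom
    · simp

theorem connected_graphJoin [Nonempty V] [Nonempty W] (G : SimpleGraph V) (H : SimpleGraph W) :
    (graphJoin G H).Connected := by
  obtain ⟨v⟩ := ‹Nonempty V›
  obtain ⟨w⟩ := ‹Nonempty W›
  have cross : ∀ a b, (graphJoin G H).Adj (.inl a) (.inr b) := fun a b => by
    simp [graphJoin, completeBipartiteGraph]
  have key : ∀ x, (graphJoin G H).Reachable (.inl v) x := by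
    rintro (a | b)
    · exact (cross v w).reachable.trans (cross a w).reachable.symm
    · exact (cross v b).reachable
  exact (connected_iff _).2 ⟨fun x y => (key x).symm.trans (key y), ⟨.inl v⟩⟩

theorem iso_left_of_isLeft_iff {G : SimpleGraph V} {H : SimpleGraph W} {G' : SimpleGraph V'}
    {H' : SimpleGraph W'} (e : G ⊕g H ≃g G' ⊕g H') (h : ∀ x, (e x).isLeft ↔ x.isLeft) :
    Nonempty (G ≃g G') := by
  have h1 : ∀ v, ∃ v', e (.inl v) = .inl v' := fun v => by
    have := (h (.inl v)).2 rfl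
    exact Sum.isLeft_iff.1 this
  have h2 : ∀ v', ∃ v, e.symm (.inl v') = .inl v := fun v' => by
    have := (h (e.symm (.inl v'))).1 (by simp)
    exact Sum.isLeft_iff.1 this
  choose f hf using h1
  choose g hg using h2
  refine ⟨⟨⟨f, g, fun v => ?_, fun v => ?_⟩, ?_⟩⟩
  · have := hg (f v)
    rw [← hf, RelIso.symm_apply_apply] at this
    exact (Sum.inl_injective this).symm
  · have := hf (g v)
    rw [← hg, RelIso.apply_symm_apply] at this
    exact (Sum.inl_injective this).symm
  · intro a b
    have := e.map_rel_iff (a := .inl a) (b := .inl b)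
    rw [hf, hf] at this
    simpa [SimpleGraph.sum] using this

/-- Cancellation of a connected component. -/
theorem iso_of_sum_iso {G : SimpleGraph V} {H : SimpleGraph W} {G' : SimpleGraph V'}
    {H' : SimpleGraph W'} (hG : G.Preconnected) (hG' : G'.Preconnected)
    (e : G ⊕g H ≃g G' ⊕g H') (v : V) (hv : (e (.inl v)).isLeft) :
    Nonempty (G ≃g G') ∧ Nonempty (H ≃g H') := by
  obtain ⟨w, hw⟩ := Sum.isLeft_iff.1 hv
  have h : ∀ x, (e x).isLeft ↔ x.isLeft := by
    intro x
    rw [← reachable_sum_inl_iff (H := H) hG v, ← reachable_sum_inl_iff (H := H') hG' w, ← hw]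
    exact Iso.reachable_iff
  -- The isomorphism preserves sides, so it restricts to the left summands and, after exchanging the
  -- summands, to the right ones.
  refine ⟨iso_left_of_isLeft_iff e h,
    iso_left_of_isLeft_iff ((Iso.sumComm.trans e).trans Iso.sumComm) fun x => ?_⟩
  have := h x.swap
  have h1 : ((Iso.sumComm.trans e).trans Iso.sumComm) x = (e x.swap).swap := rfl
  rw [h1]
  rcases x with x | x <;> rcases hx : e (Sum.swap _) with y | y <;> rw [hx] at this <;>
    simp_all

end SimpleGraph

/-! ## Graphs of cotrees -/

namespace Cotree

open SimpleGraph

theorem induction {P : Cotree → Prop} (leaf : P leaf)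
    (node : ∀ b cs, (∀ c ∈ cs, P c) → P (node b cs)) (t : Cotree) : P t :=
  Cotree.rec (motive_1 := P) (motive_2 := fun cs => ∀ c ∈ cs, P c) leaf node (by simp)
    (fun _ _ h hs => by simpa using ⟨h, hs⟩) t

mutual
/-- Exchange the types. -/
def flip : Cotree → Cotree
  | leaf => leaf
  | node b cs => node (!b) (flipList cs)
/-- Exchange the types in a list of trees. -/
def flipList : List Cotree → List Cotree
  | [] => []
  | c :: cs => flip c :: flipList cs
end

theorem flipList_eq (cs : List Cotree) : flipList cs = cs.map flip := by
  induction cs with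
  | nil => rfl
  | cons c cs ih => rw [flipList, ih, List.map_cons]

theorem rootType_flip (c : Cotree) : c.flip.rootType = c.rootType.map (!·) := by
  cases c <;> rfl

theorem IsCotree.flip {c : Cotree} (h : IsCotree c) : IsCotree c.flip := by
  induction h with
  | leaf => exact .leaf
  | node b cs two_le _ alternate ih =>
    rw [Cotree.flip, flipList_eq]
    refine .node _ _ (by simpa using two_le) ?_ ?_
    · simpa using ih
    · simp only [List.mem_map, forall_exists_index, and_imp, forall_apply_eq_imp_iff₂,
        rootType_flip]
      intro c hc h
      apply alternate c hc
      simpa using h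

/-- Exchanging types complements the graph, by De Morgan's law at each node. -/
theorem graph_flipList (b : Bool) (cs : List Cotree)
    (ih : ∀ c ∈ cs, Nonempty (c.flip.graph ≃g c.graphᶜ)) :
    Nonempty (graphList (!b) (flipList cs) ≃g (graphList b cs)ᶜ) := by
  induction cs with
  | nil => exact ⟨⟨Equiv.refl Empty, fun {a} => a.elim⟩⟩
  | cons c cs ihcs =>
    simp only [List.mem_cons, forall_eq_or_imp] at ih
    obtain ⟨e⟩ := ih.1
    obtain ⟨f⟩ := ihcs ih.2
    cases b with
    | false =>
      change Nonempty (graphJoin (flip c).graph (graphList true (flipList cs)) ≃g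
        (c.graph ⊕g graphList false cs)ᶜ)
      refine ⟨(Iso.joinCongr e f).trans ?_⟩
      rw [graphJoin_eq, compl_compl, compl_compl]
    | true =>
      change Nonempty ((flip c).graph ⊕g graphList false (flipList cs) ≃g
        (graphJoin c.graph (graphList true cs))ᶜ)
      refine ⟨(Iso.sumCongr e f).trans ?_⟩
      rw [graphJoin_eq, compl_compl]

theorem graph_flip (c : Cotree) : Nonempty (c.flip.graph ≃g c.graphᶜ) := by
  induction c using Cotree.induction with
  | leaf => exact ⟨⟨Equiv.refl Unit, by
      intro a b
      obtain rfl : a = b := Subsingleton.elim (α := Unit) a b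
      simp⟩⟩
  | node b cs ih => exact graph_flipList b cs ih

/-- The disjoint union or the join of lists of isomorphic graphs. -/
theorem graphList_congr (b : Bool) {cs ds : List Cotree}
    (h : List.Forall₂ (fun c d => Nonempty (c.graph ≃g d.graph)) cs ds) :
    Nonempty (graphList b cs ≃g graphList b ds) := by
  induction h with
  | nil => exact ⟨Iso.refl⟩
  | cons h _ ih =>
    obtain ⟨e⟩ := h
    obtain ⟨f⟩ := ih
    cases b with
    | false => exact ⟨Iso.sumCongr e f⟩
    | true => exact ⟨Iso.joinCongr e f⟩

theorem graphList_false_perm {cs ds : List Cotree} (h : cs.Perm ds) :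
    Nonempty (graphList false cs ≃g graphList false ds) := by
  induction h with
  | nil => exact ⟨Iso.refl⟩
  | cons c _ ih =>
    obtain ⟨f⟩ := ih
    exact ⟨Iso.sumCongr Iso.refl f⟩
  | swap c d cs => exact ⟨Iso.sumLeftComm _ _ _⟩
  | trans _ _ ih ih' =>
    obtain ⟨e⟩ := ih
    obtain ⟨f⟩ := ih'
    exact ⟨e.trans f⟩

/-- Transfers invariance under permutations from unions to joins. -/
theorem graphList_true_iso (cs : List Cotree) :
    Nonempty (graphList true cs ≃g (graphList false (flipList cs))ᶜ) := by
  obtain ⟨e⟩ := graph_flipList true cs fun c _ => graph_flip c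
  have := e.complCongr
  rw [compl_compl] at this
  exact ⟨this.symm⟩

theorem graphList_perm (b : Bool) {cs ds : List Cotree} (h : cs.Perm ds) :
    Nonempty (graphList b cs ≃g graphList b ds) := by
  cases b with
  | false => exact graphList_false_perm h
  | true =>
    obtain ⟨e⟩ := graphList_true_iso cs
    obtain ⟨f⟩ := graphList_true_iso ds
    obtain ⟨g⟩ := graphList_false_perm (cs := flipList cs) (ds := flipList ds) (by
      rw [flipList_eq, flipList_eq]
      exact h.map flip)
    exact ⟨(e.trans g.complCongr).trans f.symm⟩

theorem SibEquiv.graph_iso {c d : Cotree} (h : SibEquiv c d) : Nonempty (c.graph ≃g d.graph) := by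
  induction h with
  | refl c => exact ⟨Iso.refl⟩
  | trans _ _ ih ih' =>
    obtain ⟨e⟩ := ih
    obtain ⟨f⟩ := ih'
    exact ⟨e.trans f⟩
  | perm b h => exact graphList_perm b h
  | child b l r _ ih =>
    refine graphList_congr b (List.rel_append ?_ (.cons ih ?_))
    all_goals exact List.forall₂_same.2 fun _ _ => ⟨Iso.refl⟩

theorem numLeavesList_eq (cs : List Cotree) : numLeavesList cs = (cs.map numLeaves).sum := by
  induction cs with
  | nil => rfl
  | cons c cs ih => simp [numLeavesList, ih]

theorem card_vert (c : Cotree) : Finite c.Vert ∧ Nat.card c.Vert = c.numLeaves := by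
  induction c using Cotree.induction with
  | leaf => exact ⟨inferInstanceAs (Finite Unit), by simp [Vert, numLeaves]⟩
  | node b cs ih =>
    change Finite (VertList cs) ∧ Nat.card (VertList cs) = numLeavesList cs
    induction cs with
    | nil => exact ⟨inferInstanceAs (Finite Empty), by simp [VertList, numLeavesList]⟩
    | cons c cs ihcs =>
      simp only [List.mem_cons, forall_eq_or_imp] at ih
      obtain ⟨h1, h2⟩ := ih.1
      obtain ⟨h3, h4⟩ := ihcs ih.2
      refine ⟨inferInstanceAs (Finite (c.Vert ⊕ VertList cs)), ?_⟩
      change Nat.card (c.Vert ⊕ VertList cs) = _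
      rw [Nat.card_sum, h2, h4, numLeavesList]

/-- The graph of a list ends in a summand without vertices, which is absorbed by an isomorphism at
the last tree. -/
theorem isCograph_graphList (b : Bool) {cs : List Cotree} (h0 : cs ≠ [])
    (h : ∀ c ∈ cs, IsCograph c.graph) : IsCograph (graphList b cs) := by
  induction cs with
  | nil => exact absurd rfl h0
  | cons c cs ih =>
    simp only [List.mem_cons, forall_eq_or_imp] at h
    rcases eq_or_ne cs [] with rfl | hcs
    · have : IsEmpty (VertList []) := inferInstanceAs (IsEmpty Empty)
      cases b with
      | false => exact .iso (Iso.sumEmpty c.graph (graphList false [])).symm h.1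
      | true => exact .iso (Iso.joinEmpty c.graph (graphList true [])).symm h.1
    · cases b with
      | false => exact .union h.1 (ih hcs h.2)
      | true =>
        change IsCograph (graphJoin c.graph (graphList true cs))
        rw [graphJoin_eq]
        exact .compl (.union (.compl h.1) (.compl (ih hcs h.2)))

theorem IsCotree.isCograph {c : Cotree} (h : IsCotree c) : IsCograph c.graph := by
  induction h with
  | leaf =>
    have : Subsingleton Cotree.leaf.Vert := inferInstanceAs (Subsingleton Unit)
    have : Nonempty Cotree.leaf.Vert := inferInstanceAs (Nonempty Unit)
    exact .single _
  | node b cs two_le _ _ ih =>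
    exact isCograph_graphList b (by rintro rfl; simp at two_le) ih

theorem graphList_false_append (cs ds : List Cotree) :
    Nonempty (graphList false cs ⊕g graphList false ds ≃g graphList false (cs ++ ds)) := by
  induction cs with
  | nil =>
    have : IsEmpty (VertList []) := inferInstanceAs (IsEmpty Empty)
    exact ⟨Iso.sumComm.trans (Iso.sumEmpty _ _)⟩
  | cons c cs ih =>
    obtain ⟨e⟩ := ih
    exact ⟨Iso.sumAssoc.trans (Iso.sumCongr Iso.refl e)⟩

/-- A cotree is a disjoint union of cotrees whose roots are not of type 0. -/
theorem IsCotree.exists_parts {c : Cotree} (h : IsCotree c) :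
    ∃ cs : List Cotree, cs ≠ [] ∧ (∀ d ∈ cs, IsCotree d) ∧
      (∀ d ∈ cs, d.rootType ≠ some false) ∧ Nonempty (c.graph ≃g graphList false cs) := by
  by_cases hr : c.rootType = some false
  · cases h with
    | leaf => simp [rootType] at hr
    | node b cs two_le isCotree alternate =>
      obtain rfl : b = false := by simpa [rootType] using hr
      exact ⟨cs, by rintro rfl; simp at two_le, isCotree, alternate, ⟨Iso.refl⟩⟩
  · have : IsEmpty (VertList []) := inferInstanceAs (IsEmpty Empty)
    exact ⟨[c], by simp, by simpa using h, by simpa using hr,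
      ⟨(Iso.sumEmpty c.graph (graphList false [])).symm⟩⟩

end Cotree

open Cotree in
/-- Every cograph is the graph of a cotree. -/
theorem IsCograph.exists_cotree {V : Type*} {G : SimpleGraph V} (h : IsCograph G) :
    ∃ c : Cotree, c.IsCotree ∧ Nonempty (G ≃g c.graph) := by
  induction h with
  | @single V _ _ G =>
    have : Unique V := @Unique.mk' V ⟨Classical.arbitrary V⟩ _
    refine ⟨leaf, .leaf, ⟨⟨(Equiv.equivPUnit V).trans (Equiv.refl Unit), ?_⟩⟩⟩
    intro a b
    obtain rfl : a = b := Subsingleton.elim a b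
    simp
  | compl _ ih =>
    obtain ⟨c, hc, ⟨e⟩⟩ := ih
    obtain ⟨f⟩ := graph_flip c
    exact ⟨c.flip, hc.flip, ⟨e.complCongr.trans f.symm⟩⟩
  | union _ _ ih ih' =>
    obtain ⟨c, hc, ⟨e⟩⟩ := ih
    obtain ⟨d, hd, ⟨f⟩⟩ := ih'
    -- Roots of type 0 must be dissolved, since otherwise types would not alternate below the new
    -- root of type 0.
    obtain ⟨cs, hc0, hc1, hc2, ⟨e'⟩⟩ := hc.exists_parts
    obtain ⟨ds, hd0, hd1, hd2, ⟨f'⟩⟩ := hd.exists_parts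
    obtain ⟨g⟩ := graphList_false_append cs ds
    refine ⟨node false (cs ++ ds), .node _ _ ?_ ?_ ?_,
      ⟨(SimpleGraph.Iso.sumCongr (e.trans e') (f.trans f')).trans g⟩⟩
    · have := List.length_pos_of_ne_nil hc0
      have := List.length_pos_of_ne_nil hd0
      rw [List.length_append]
      omega
    · simpa [or_imp, forall_and] using ⟨hc1, hd1⟩
    · intro x hx
      rcases List.mem_append.1 hx with hx | hx
      · exact hc2 x hx
      · exact hd2 x hx
  | iso e _ ih =>
    obtain ⟨c, hc, ⟨f⟩⟩ := ih
    exact ⟨c, hc, ⟨e.symm.trans f⟩⟩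

/-! ## Cotrees of shapes -/

namespace Shape

open SimpleGraph

mutual
/-- The cotree of a shape with the given type of the root. -/
def toCotree : Bool → Shape → Cotree
  | _, leaf => .leaf
  | b, node cs => .node b (toCotreeList (!b) cs)
/-- The cotrees of a list of shapes with the given type of their roots. -/
def toCotreeList : Bool → List Shape → List Cotree
  | _, [] => []
  | b, c :: cs => toCotree b c :: toCotreeList b cs
end

theorem toCotreeList_eq (b : Bool) (cs : List Shape) :
    toCotreeList b cs = cs.map (toCotree b) := by
  induction cs with
  | nil => rfl
  | cons c cs ih => rw [toCotreeList, ih, List.map_cons]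

theorem rootType_toCotree (b : Bool) (t : Shape) : (t.toCotree b).rootType ≠ some (!b) := by
  cases t <;> simp [toCotree, Cotree.rootType]

theorem numLeaves_toCotree (t : Shape) : ∀ b, (t.toCotree b).numLeaves = t.leaves := by
  induction t using Shape.induction with
  | leaf => intro b; rfl
  | node cs ih =>
    intro b
    rw [toCotree, Cotree.numLeaves, leaves, toCotreeList_eq, Cotree.numLeavesList_eq,
      leavesList_eq, sizes, List.map_map]
    congr 1
    exact List.map_congr_left fun c hc => ih c hc _

theorem Canon.isCotree {t : Shape} (h : Canon t) : ∀ b, (t.toCotree b).IsCotree := by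
  induction h with
  | leaf => intro b; exact .leaf
  | node cs two_le _ _ ih =>
    intro b
    rw [toCotree, toCotreeList_eq]
    refine .node _ _ (by simpa using two_le) ?_ ?_
    · simpa using fun c hc => ih c hc _
    · simp only [List.mem_map, forall_exists_index, and_imp, forall_apply_eq_imp_iff₂]
      intro c _
      simpa using rootType_toCotree (!b) c

theorem flip_toCotree (t : Shape) : ∀ b, (t.toCotree b).flip = t.toCotree (!b) := by
  induction t using Shape.induction with
  | leaf => intro b; rfl
  | node cs ih =>
    intro b
    rw [toCotree, toCotree, Cotree.flip, toCotreeList_eq, toCotreeList_eq, Cotree.flipList_eq,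
      List.map_map]
    congr 1
    exact List.map_congr_left fun c hc => ih c hc _

/-! ## Existence of canonical shapes -/

/-- Canonical trees of equal size lie on one deterministic sequence, so one is reachable from the
other. -/
theorem sibLE_total {s t : Shape} (hs : Canon s) (ht : Canon t) : SibLE s t ∨ SibLE t s := by
  rcases lt_trichotomy s.leaves t.leaves with h | h | h
  · exact .inl (.inl h)
  · obtain ⟨M, -, -, -, hM⟩ := exists_endsAt s.leaves hs.leaves_pos
    rcases reach_total (hM s hs rfl).1 (hM t ht h.symm).1 with h' | h'
    · exact .inl (.inr ⟨h, h'⟩)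
    · exact .inr (.inr ⟨h.symm, h'⟩)
  · exact .inr (.inl h)

theorem sibLE_antisymm {s t : Shape} (hs : Canon s) (h : SibLE s t) (h' : SibLE t s) :
    s = t := by
  have h1 := h.leaves_le
  have h2 := h'.leaves_le
  obtain ⟨M, -, -, hM0, hM⟩ := exists_endsAt s.leaves hs.leaves_pos
  rcases h with h | ⟨-, h⟩
  · omega
  rcases h' with h' | ⟨-, h'⟩
  · omega
  exact reach_antisymm hM0 (hM s hs rfl).2 h h'

/-- Totality is known only for canonical trees, so the sorting takes place in their subtype. -/
theorem exists_perm_sorted {ts : List Shape} (h : ∀ t ∈ ts, Canon t) :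
    ∃ us : List Shape, us.Perm ts ∧ us.Pairwise SibLE := by
  classical
  let r : {t // Canon t} → {t // Canon t} → Prop := fun s t => SibLE s.1 t.1
  have : Std.Total r := ⟨fun s t => sibLE_total s.2 t.2⟩
  have : IsTrans _ r := ⟨fun _ _ _ => SibLE.trans⟩
  refine ⟨((ts.pmap Subtype.mk h).insertionSort r).map Subtype.val, ?_, ?_⟩
  · refine ((List.perm_insertionSort r _).map _).trans ?_
    rw [List.map_pmap]
    simp
  · exact List.pairwise_map.2 (List.pairwise_insertionSort r _)

/-- Children are replaced one at a time; the prefix l holds those already done. -/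
theorem sibEquiv_of_forall₂ (b : Bool) {cs ds : List Cotree}
    (h : List.Forall₂ Cotree.SibEquiv cs ds) (l : List Cotree) :
    (Cotree.node b (l ++ cs)).SibEquiv (.node b (l ++ ds)) := by
  induction h generalizing l with
  | nil => exact .refl _
  | @cons c d cs ds h _ ih =>
    refine .trans (.child b l cs h) ?_
    simpa using ih (l ++ [d])

/-- Every cotree is the cotree of a canonical shape, up to sibling permutations. -/
theorem exists_canon {c : Cotree} (h : c.IsCotree) : ∃ t, Canon t ∧
    ∀ b, c.rootType ≠ some (!b) → c.SibEquiv (t.toCotree b) := by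
  induction h with
  | leaf => exact ⟨leaf, .leaf, fun b _ => .refl _⟩
  | node b cs two_le _ alternate ih =>
    have : Nonempty Shape := ⟨Shape.leaf⟩
    choose! f hf using ih
    have hc : ∀ t ∈ cs.map f, Canon t := by simpa using fun c hc => (hf c hc).1
    obtain ⟨us, hperm, hsort⟩ := exists_perm_sorted hc
    refine ⟨node us, .node us ?_ (fun t ht => hc t (hperm.mem_iff.1 ht)) hsort, ?_⟩
    · simpa [hperm.length_eq] using two_le
    · intro b' hb'
      obtain rfl : b = b' := by
        simp only [Cotree.rootType, ne_eq, Option.some.injEq] at hb'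
        cases b <;> cases b' <;> simp_all
      rw [toCotree, toCotreeList_eq]
      refine .trans (d := .node b ((cs.map f).map (toCotree (!b)))) ?_ (.perm b (hperm.symm.map _))
      refine sibEquiv_of_forall₂ b ?_ []
      rw [List.map_map]
      refine List.forall₂_map_right_iff.2 (List.forall₂_same.2 fun c hc => ?_)
      exact (hf c hc).2 _ (by simpa using alternate c hc)

/-! ## Uniqueness of canonical shapes -/

theorem Canon.nonempty_vert {t : Shape} (h : Canon t) (b : Bool) :
    Nonempty (t.toCotree b).Vert := by
  obtain ⟨_, h1⟩ := (t.toCotree b).card_vert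
  have h2 := h.leaves_pos
  rw [← numLeaves_toCotree t b, ← h1] at h2
  exact (Nat.card_pos_iff.1 h2).1

theorem leaves_eq_of_iso {s t : Shape} {b b' : Bool}
    (e : (s.toCotree b).graph ≃g (t.toCotree b').graph) : s.leaves = t.leaves := by
  rw [← numLeaves_toCotree s b, ← numLeaves_toCotree t b', ← (Cotree.card_vert _).2,
    ← (Cotree.card_vert _).2]
  exact Nat.card_congr e.toEquiv

/-- A node has at least two children with nonempty graphs: their union is disconnected and their
join is connected. Thus the graph determines the root type. -/
theorem Canon.connected_iff {cs : List Shape} (h : Canon (.node cs)) (b : Bool) :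
    ((Shape.node cs).toCotree b).graph.Connected ↔ b = true := by
  cases h with
  | node _ two_le canon _ =>
    match cs, two_le with
    | c :: d :: cs, _ =>
      have h1 := fun b => (canon c (by simp)).nonempty_vert b
      have h2 : ∀ b, Nonempty (Cotree.VertList (toCotreeList b (d :: cs))) := fun b =>
        ((canon d (by simp)).nonempty_vert b).map Sum.inl
      cases b with
      | false =>
        refine iff_of_false ?_ (by simp)
        exact not_connected_sum (G := (toCotree true c).graph)
          (H := Cotree.graphList false (toCotreeList true (d :: cs)))
      | true =>
        refine iff_of_true ?_ rfl
        exact connected_graphJoin (toCotree false c).graph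
          (Cotree.graphList true (toCotreeList false (d :: cs)))

theorem Canon.preconnected_true {t : Shape} (h : Canon t) :
    (t.toCotree true).graph.Preconnected := by
  cases t with
  | leaf =>
    have : Subsingleton (toCotree true Shape.leaf).Vert := inferInstanceAs (Subsingleton Unit)
    intro x y
    rw [Subsingleton.elim x y]
  | node cs => exact ((h.connected_iff true).2 rfl).preconnected

/-- Moves the child that contains the given vertex to the front, ready for cancellation. -/
theorem exists_component (cs : List Cotree) (x : Cotree.VertList cs) :
    ∃ l c r, cs = l ++ c :: r ∧
      ∃ φ : Cotree.graphList false cs ≃g c.graph ⊕g Cotree.graphList false (l ++ r),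
        (φ x).isLeft := by
  induction cs with
  | nil => exact Empty.elim x
  | cons d cs ih =>
    obtain y | y : d.Vert ⊕ Cotree.VertList cs := x
    · exact ⟨[], d, cs, rfl, Iso.refl, rfl⟩
    · obtain ⟨l, c, r, rfl, φ, hφ⟩ := ih y
      obtain ⟨z, hz⟩ := Sum.isLeft_iff.1 hφ
      refine ⟨d :: l, c, r, rfl, (Iso.sumCongr Iso.refl φ).trans (Iso.sumLeftComm _ _ _), ?_⟩
      change ((Iso.sumLeftComm d.graph c.graph (Cotree.graphList false (l ++ r)))
        (.inr (φ y))).isLeft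
      rw [hz]
      rfl

/-- The image of a vertex of the first child lies in some child d on the other side. Both graphs are
connected, so they correspond; `ih` identifies the children, and the rest cancels. -/
theorem perm_of_iso {cs ds : List Shape}
    (ih : ∀ c ∈ cs, ∀ d, Canon c → Canon d →
      Nonempty ((c.toCotree true).graph ≃g (d.toCotree true).graph) → c = d)
    (hc : ∀ c ∈ cs, Canon c) (hd : ∀ d ∈ ds, Canon d)
    (e : Cotree.graphList false (toCotreeList true cs) ≃g
      Cotree.graphList false (toCotreeList true ds)) : cs.Perm ds := by
  induction cs generalizing ds with
  | nil =>
    cases ds with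
    | nil => exact .nil
    | cons d ds =>
      obtain ⟨v⟩ := (hd d (by simp)).nonempty_vert true
      exact Empty.elim (e.symm (Sum.inl v))
  | cons c cs ihcs =>
    simp only [List.mem_cons, forall_eq_or_imp] at ih hc
    obtain ⟨v⟩ := hc.1.nonempty_vert true
    obtain ⟨l, d', r, hds, φ, hφ⟩ := exists_component (toCotreeList true ds) (e (Sum.inl v))
    rw [toCotreeList_eq] at hds
    obtain ⟨l₀, r₀', rfl, rfl, h2⟩ := List.map_eq_append_iff.1 hds
    obtain ⟨d, r₀, rfl, rfl, rfl⟩ := List.map_eq_cons_iff.1 h2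
    have hdc : Canon d := hd d (by simp)
    obtain ⟨h3, ⟨f⟩⟩ := iso_of_sum_iso hc.1.preconnected_true hdc.preconnected_true
      (e.trans φ) v hφ
    obtain rfl := ih.1 d hc.1 hdc h3
    rw [← List.map_append, ← toCotreeList_eq] at f
    refine (List.Perm.cons c (ihcs ih.2 hc.2 (fun x hx => hd x ?_) f)).trans
      List.perm_middle.symm
    rcases List.mem_append.1 hx with hx | hx <;> simp [hx]

/-- Canonical shapes with isomorphic graphs are equal. -/
theorem eq_of_iso {s : Shape} : ∀ {t : Shape} {b b' : Bool}, Canon s → Canon t →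
    Nonempty ((s.toCotree b).graph ≃g (t.toCotree b').graph) → s = t ∧ (s = leaf ∨ b = b') := by
  induction s using Shape.induction with
  | leaf =>
    rintro t b b' hs ht ⟨e⟩
    have h := leaves_eq_of_iso e
    cases t with
    | leaf => simp
    | node ds =>
      have := ht.two_le_leaves
      simp [leaves] at h this
      omega
  | node cs ih =>
    rintro t b b' hs ht ⟨e⟩
    cases t with
    | leaf =>
      have h := leaves_eq_of_iso e
      have := hs.two_le_leaves
      simp [leaves] at h this
      omega
    | node ds =>
      have hb : b = b' := by
        have h1 := hs.connected_iff b
        rw [e.connected_iff, ht.connected_iff] at h1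
        cases b <;> cases b' <;> simp_all
      subst hb
      refine ⟨?_, .inr rfl⟩
      -- Taking complements turns a root of type 1 into one of type 0, so only disjoint unions have
      -- to be decomposed.
      have e' : Nonempty (((node cs).toCotree false).graph ≃g
          ((node ds).toCotree false).graph) := by
        cases b with
        | false => exact ⟨e⟩
        | true =>
          obtain ⟨f⟩ := ((node cs).toCotree true).graph_flip
          obtain ⟨g⟩ := ((node ds).toCotree true).graph_flip
          rw [flip_toCotree] at f g
          exact ⟨(f.trans e.complCongr).trans g.symm⟩
      obtain ⟨e'⟩ := e'
      cases hs with
      | node _ _ hc hcs =>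
        cases ht with
        | node _ _ hd hds =>
          have hp : cs.Perm ds :=
            perm_of_iso (fun c hc d h h' hcd => (ih c hc h h' hcd).1) hc hd e'
          rw [hp.eq_of_pairwise (fun a b ha _ => sibLE_antisymm (hc a ha)) hcs hds]

end Shape

/-! ## Running times of the procedures -/

/-- `Red c d T`: in time at most `T`, without output and without a change of the stack, the code
`c` leads to the code `d`. -/
def Red (c d : Code Val) (T : ℕ) : Prop :=
  ∀ ks t w, ∃ k t', t' ≤ t + T ∧ State.step^[k] ⟨c, ks, t, w⟩ = ⟨d, ks, t', w⟩

namespace Red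

variable {c d e : Code Val} {T T' : ℕ}

theorem refl (c : Code Val) : Red c c 0 := fun _ t _ => ⟨0, t, le_rfl, rfl⟩

theorem trans (h : Red c d T) (h' : Red d e T') : Red c e (T + T') := by
  intro ks t w
  obtain ⟨k, t₁, h1, h2⟩ := h ks t w
  obtain ⟨k', t₂, h3, h4⟩ := h' ks t₁ w
  exact ⟨k' + k, t₂, by omega, by rw [Function.iterate_add_apply, h2, h4]⟩

theorem mono (h : Red c d T) (hT : T ≤ T') : Red c d T' := by
  intro ks t w
  obtain ⟨k, t₁, h1, h2⟩ := h ks t w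
  exact ⟨k, t₁, by omega, h2⟩

theorem of_step (hs : ∀ ks t w, State.step ⟨c, ks, t, w⟩ = ⟨d, ks, t + 1, w⟩) (h : Red d e T) :
    Red c e (T + 1) := by
  intro ks t w
  obtain ⟨k, t₁, h1, h2⟩ := h ks (t + 1) w
  exact ⟨k + 1, t₁, by omega, by rw [Function.iterate_succ_apply, hs, h2]⟩

variable {x y a b : Val} {f : Proc} {xs : List Val} {n : Val → Code Val} {p q : Code Val} {m : ℕ}

theorem num (h : Red (n (.num m)) d T) : Red (.num m n) d (T + 1) := h.of_step fun _ _ _ => rfl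
theorem nil (h : Red (n .nil) d T) : Red (.nil n) d (T + 1) := h.of_step fun _ _ _ => rfl
theorem cons (h : Red (n (.cons x y)) d T) : Red (.cons x y n) d (T + 1) :=
  h.of_step fun _ _ _ => rfl
theorem head (h : Red (n x.head) d T) : Red (.head x n) d (T + 1) := h.of_step fun _ _ _ => rfl
theorem tail (h : Red (n x.tail) d T) : Red (.tail x n) d (T + 1) := h.of_step fun _ _ _ => rfl
theorem add (h : Red (n (.num (x.toNat + y.toNat))) d T) : Red (.add x y n) d (T + 1) :=
  h.of_step fun _ _ _ => rfl
theorem sub (h : Red (n (.num (x.toNat - y.toNat))) d T) : Red (.sub x y n) d (T + 1) :=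
  h.of_step fun _ _ _ => rfl
theorem div (h : Red (n (.num (x.toNat / y.toNat))) d T) : Red (.div x y n) d (T + 1) :=
  h.of_step fun _ _ _ => rfl
theorem mod (h : Red (n (.num (x.toNat % y.toNat))) d T) : Red (.mod x y n) d (T + 1) :=
  h.of_step fun _ _ _ => rfl
theorem ifNil_nil (h : Red p d T) : Red (.ifNil .nil p q) d (T + 1) :=
  h.of_step fun _ _ _ => rfl
theorem ifNil_cons (h : Red q d T) : Red (.ifNil (.cons a b) p q) d (T + 1) :=
  h.of_step fun _ _ _ => rfl
theorem ifEq_pos (hxy : x.toNat = y.toNat) (h : Red p d T) : Red (.ifEq x y p q) d (T + 1) :=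
  h.of_step fun _ _ _ => by rw [State.step, if_pos hxy]
theorem ifEq_neg (hxy : x.toNat ≠ y.toNat) (h : Red q d T) : Red (.ifEq x y p q) d (T + 1) :=
  h.of_step fun _ _ _ => by rw [State.step, if_neg hxy]
theorem ifLe_pos (hxy : x.toNat ≤ y.toNat) (h : Red p d T) : Red (.ifLe x y p q) d (T + 1) :=
  h.of_step fun _ _ _ => by rw [State.step, if_pos hxy]
theorem ifLe_neg (hxy : ¬ x.toNat ≤ y.toNat) (h : Red q d T) : Red (.ifLe x y p q) d (T + 1) :=
  h.of_step fun _ _ _ => by rw [State.step, if_neg hxy]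
theorem jump (h : Red (Code.body f xs) d T) : Red (.jump f xs) d (T + 1) :=
  h.of_step fun _ _ _ => rfl

/-- The two extra units are the call and the return. -/
theorem call (h : Red (Code.body f xs) (.ret x) T) (h' : Red (n x) d T') :
    Red (.call f xs n) d (T + T' + 2) := by
  intro ks t w
  obtain ⟨k, t₁, h1, h2⟩ := h (n :: ks) (t + 1) w
  obtain ⟨k', t₂, h3, h4⟩ := h' ks (t₁ + 1) w
  refine ⟨k' + 1 + (k + 1), t₂, by omega, ?_⟩
  have e1 : State.step ⟨.call f xs n, ks, t, w⟩ = ⟨Code.body f xs, n :: ks, t + 1, w⟩ := rfl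
  have e2 : State.step ⟨.ret x, n :: ks, t₁, w⟩ = ⟨n x, ks, t₁ + 1, w⟩ := rfl
  rw [Function.iterate_add_apply, Function.iterate_succ_apply, Function.iterate_succ_apply,
    e1, h2, e2, h4]

end Red

-- Representation of data, and numbers of nodes

namespace Val

/-- The datum that represents the list `l`, followed by `z`. -/
def ofList : List Val → Val → Val
  | [], z => z
  | x :: l, z => cons x (ofList l z)

theorem ofList_append (l l' : List Val) (z : Val) :
    ofList (l ++ l') z = ofList l (ofList l' z) := by
  induction l with
  | nil => rfl
  | cons x l ih => rw [List.cons_append, ofList, ih, ofList]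

/-- The datum that represents a list of numbers. -/
def ofNats (a : List ℕ) : Val := ofList (a.map num) nil

end Val

namespace Shape

mutual
/-- The number of nodes. -/
def nodes : Shape → ℕ
  | leaf => 1
  | node cs => 1 + nodesList cs
/-- The total number of nodes of a list of shapes. -/
def nodesList : List Shape → ℕ
  | [] => 0
  | c :: cs => nodes c + nodesList cs
end

mutual
/-- The datum that represents a labeled tree. -/
def toVal : Shape → Val
  | leaf => .cons (.num 1) .nil
  | node cs => .cons (.num (leavesList cs)) (toValList cs)
/-- The datum that represents a list of labeled trees. -/
def toValList : List Shape → Val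
  | [] => .nil
  | c :: cs => .cons (toVal c) (toValList cs)
end

theorem toValList_eq (cs : List Shape) : toValList cs = Val.ofList (cs.map toVal) .nil := by
  induction cs with
  | nil => rfl
  | cons c cs ih => rw [toValList, ih, List.map_cons, Val.ofList]

theorem head_toVal (t : Shape) : t.toVal.head = .num t.leaves := by
  cases t <;> rfl

theorem nodesList_append (cs ds : List Shape) :
    nodesList (cs ++ ds) = nodesList cs + nodesList ds := by
  induction cs with
  | nil => simp [nodesList]
  | cons c cs ih => simp [nodesList, ih]; omega

theorem leavesList_append (cs ds : List Shape) :
    leavesList (cs ++ ds) = leavesList cs + leavesList ds := by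
  simp [leavesList_eq, sizes]

theorem leavesList_cons (c : Shape) (ds : List Shape) :
    leavesList (c :: ds) = leaves c + leavesList ds := rfl

theorem nodesList_cons (c : Shape) (ds : List Shape) :
    nodesList (c :: ds) = nodes c + nodesList ds := rfl

theorem nodes_pos (t : Shape) : 1 ≤ t.nodes := by
  cases t <;> simp [nodes]

theorem length_le_nodesList (cs : List Shape) : cs.length ≤ nodesList cs := by
  induction cs with
  | nil => simp [nodesList]
  | cons c cs ih =>
    have := c.nodes_pos
    simp [nodesList]
    omega

theorem leaves_le_nodes (t : Shape) : t.leaves ≤ t.nodes := by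
  induction t using Shape.induction with
  | leaf => simp [leaves, nodes]
  | node cs ih =>
    suffices h : leavesList cs ≤ nodesList cs by simp only [leaves, nodes]; omega
    induction cs with
    | nil => simp [leavesList]
    | cons c cs ihcs =>
      simp only [List.mem_cons, forall_eq_or_imp] at ih
      have := ihcs ih.2
      simp only [leavesList, nodesList]
      omega

/-- Each child contributes at most twice its leaves minus one, and the saving of at least two units
pays for the parent. Hence time linear in the nodes is linear in n. -/
theorem Canon.nodes_lt {t : Shape} (h : Canon t) : t.nodes < 2 * t.leaves := by
  induction h with
  | leaf => simp [leaves, nodes]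
  | node cs two_le _ _ ih =>
    suffices h : nodesList cs + cs.length ≤ 2 * leavesList cs by
      simp only [leaves, nodes]; omega
    clear two_le
    induction cs with
    | nil => simp [leavesList, nodesList]
    | cons c cs ihcs =>
      simp only [List.mem_cons, forall_eq_or_imp] at ih
      have := ihcs (by simp_all) (by simp_all) ih.2
      simp only [leavesList, nodesList, List.length_cons]
      omega

-- Procedures on lists and trees

open Code (body)
open Val (ofList ofList_append ofNats)

theorem red_revAppend (xs : List Val) (y : Val) :
    Red (body .revAppend [ofList xs .nil, y]) (.ret (ofList xs.reverse y))
      (5 * xs.length + 1) := by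
  induction xs generalizing y with
  | nil => exact .ifNil_nil (.refl _)
  | cons x xs ih =>
    rw [List.reverse_cons, ofList_append]
    exact Red.mono (.ifNil_cons <| .head <| .tail <| .cons <| .jump <| ih _) (by simp; omega)

theorem red_sum (a : List ℕ) (s : ℕ) :
    Red (body .sum [ofNats a, .num s]) (.ret (.num (s + a.sum))) (5 * a.length + 1) := by
  induction a generalizing s with
  | nil => exact .ifNil_nil (.refl _)
  | cons x a ih =>
    rw [List.sum_cons, ← add_assoc]
    exact Red.mono (.ifNil_cons <| .head <| .tail <| .add <| .jump <| ih _) (by simp; omega)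

theorem red_ones (m : ℕ) :
    Red (body .ones [.num m]) (.ret (ofNats (List.replicate m 1))) (8 * m + 4) := by
  induction m with
  | zero => exact .num <| .num <| .nil <| .ifEq_pos rfl <| .refl _
  | succ m ih =>
    exact Red.mono (.num <| .num <| .nil <| .ifEq_neg (Nat.succ_ne_zero m) <| .sub <| .call ih <|
      .cons <| .refl _) (by omega)

theorem red_repeatPush (q : ℕ) (x y : Val) :
    Red (body .repeatPush [.num q, x, y]) (.ret (ofList (List.replicate q x) y))
      (6 * q + 3) := by
  induction q generalizing y with
  | zero => exact .num <| .num <| .ifEq_pos rfl <| .refl _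
  | succ q ih =>
    rw [List.replicate_succ', ofList_append]
    exact Red.mono (.num <| .num <| .ifEq_neg (Nat.succ_ne_zero q) <| .sub <| .cons <|
      .jump <| ih _) (by omega)

theorem red_leafList (m : ℕ) :
    Red (body .leafList [.num m]) (.ret (toValList (List.replicate m leaf))) (9 * m + 4) := by
  induction m with
  | zero => exact .num <| .num <| .nil <| .ifEq_pos rfl <| .refl _
  | succ m ih =>
    exact Red.mono (.num <| .num <| .nil <| .ifEq_neg (Nat.succ_ne_zero m) <| .sub <| .call ih <|
      .cons <| .cons <| .refl _) (by omega)

theorem red_rebuildChildren {a : List ℕ} (h : ∀ x ∈ a, 1 ≤ x) :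
    Red (body .rebuildChildren [ofNats a]) (.ret (toValList (a.map star)))
      (25 * a.sum + 3) := by
  induction a with
  | nil => exact .num <| .nil <| .ifNil_nil <| .refl _
  | cons x a ih =>
    simp only [List.mem_cons, forall_eq_or_imp] at h
    rw [List.sum_cons]
    by_cases hx : x ≤ 1
    · obtain rfl : x = 1 := by omega
      exact Red.mono (.num <| .nil <| .ifNil_cons <| .head <| .tail <| .call (ih h.2) <|
        .ifLe_pos hx <| .cons <| .cons <| .refl _) (by omega)
    · have hs : star x = node (List.replicate x leaf) := if_neg hx
      have hl : leavesList (List.replicate x leaf) = x := by simp [leavesList_eq, sizes, leaves]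
      rw [List.map_cons, toValList, hs, toVal, hl]
      exact Red.mono (.num <| .nil <| .ifNil_cons <| .head <| .tail <| .call (ih h.2) <|
        .ifLe_neg hx <| .call (red_leafList x) <| .cons <| .cons <| .refl _) (by omega)

theorem red_rebuildNode {a : List ℕ} (h : ∀ x ∈ a, 1 ≤ x) :
    Red (body .rebuildNode [.num a.sum, ofNats a]) (.ret (node (a.map star)).toVal)
      (25 * a.sum + 6) := by
  have hl : leavesList (a.map star) = a.sum := by rw [leavesList_eq, sizes_map_star h]
  rw [toVal, hl]
  exact Red.mono (.call (red_rebuildChildren h) <| .cons <| .refl _) (by omega)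

theorem red_inducedPartition (cs : List Shape) :
    Red (body .inducedPartition [toValList cs]) (.ret (ofNats (sizes cs)))
      (8 * cs.length + 2) := by
  induction cs with
  | nil => exact .nil <| .ifNil_nil <| .refl _
  | cons c cs ih =>
    have h : (toValList (c :: cs)).head.head = .num c.leaves := head_toVal c
    have hs : ofNats (sizes (c :: cs)) =
        .cons (toValList (c :: cs)).head.head (ofNats (sizes cs)) := by
      rw [h]
      rfl
    rw [hs]
    exact Red.mono (.nil <| .ifNil_cons <| .head <| .tail <| .head <| .call ih <|
      .cons <| .refl _) (by simp; omega)

/-- The 9 units missing from the bound for a single tree pay for its list cell, so that the bounds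
add up. -/
theorem red_copyList (cs : List Shape)
    (ih : ∀ c ∈ cs, Red (body .copy [c.toVal]) (.ret c.toVal) (16 * c.nodes - 9)) :
    Red (body .copyList [toValList cs]) (.ret (toValList cs)) (16 * nodesList cs + 2) := by
  induction cs with
  | nil => exact .nil <| .ifNil_nil <| .refl _
  | cons c cs ihcs =>
    simp only [List.mem_cons, forall_eq_or_imp] at ih
    have := c.nodes_pos
    exact Red.mono (.nil <| .ifNil_cons <| .head <| .tail <| .call ih.1 <|
      .call (ihcs ih.2) <| .cons <| .refl _) (by simp only [nodesList]; omega)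

theorem red_copy (t : Shape) : Red (body .copy [t.toVal]) (.ret t.toVal) (16 * t.nodes - 9) := by
  induction t using Shape.induction with
  | leaf =>
    exact Red.mono (.head <| .tail <| .call (red_copyList [] (by simp)) <| .cons <| .refl _)
      (by simp [nodes, nodesList])
  | node cs ih =>
    exact Red.mono (.head <| .tail <| .call (red_copyList cs ih) <| .cons <| .refl _)
      (by simp only [nodes]; omega)

/-- The cost is charged to the replaced siblings: a copy of x has fewer than twice as many nodes as
the sibling has leaves. A sibling whose size differs from that of x has at least two leaves, so that
rebuilding it gives a star. -/
theorem red_restart {x : Shape} (hx : Canon x) {ys : List Shape} (hy : ∀ y ∈ ys, Canon y)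
    (hxy : ∀ y ∈ ys, x.leaves ≤ y.leaves) :
    Red (body .restart [x.toVal, toValList ys]) (.ret (toValList (restart x (sizes ys))))
      (60 * leavesList ys + 2) := by
  induction ys with
  | nil => exact .nil <| .ifNil_nil <| .refl _
  | cons y ys ih =>
    simp only [List.mem_cons, forall_eq_or_imp] at hy hxy
    have ih := ih hy.2 hxy.2
    have hpos := hy.1.leaves_pos
    have hxpos := hx.leaves_pos
    have hn := hx.nodes_lt
    have hnx := x.nodes_pos
    have hyv : (toValList (y :: ys)).head.head = .num y.leaves := head_toVal y
    have hxv := head_toVal x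
    rw [leavesList_cons]
    by_cases h : y.leaves = x.leaves
    · have hr : restart x (sizes (y :: ys)) = x :: restart x (sizes ys) := by
        simp [restart, sizes, h]
      rw [hr]
      exact Red.mono (.nil <| .ifNil_cons <| .head <| .tail <| .call ih <| .head <| .head <|
        .ifEq_pos (by rw [hyv, hxv]; exact h) <| .call (red_copy x) <| .cons <| .refl _)
        (by omega)
    · have hr : restart x (sizes (y :: ys)) = star y.leaves :: restart x (sizes ys) := by
        simp [restart, sizes, h]
      have hl : y.leaves = (List.replicate y.leaves 1).sum := by simp
      have hs : star y.leaves = node ((List.replicate y.leaves 1).map star) := by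
        rw [star, if_neg (by omega)]
        simp [star]
      have hone := red_ones y.leaves
      have hreb := red_rebuildNode (a := List.replicate y.leaves 1) (by simp)
      rw [← hs, ← hl, ← hyv] at hreb
      rw [← hyv] at hone
      rw [hr]
      exact Red.mono (.nil <| .ifNil_cons <| .head <| .tail <| .call ih <| .head <| .head <|
        .ifEq_neg (by rw [hyv, hxv]; exact h) <| .call hone <| .call hreb <| .cons <|
        .refl _) (by omega)

theorem red_toCotreeList (cs : List Shape)
    (ih : ∀ c ∈ cs, ∀ b : Bool, Red (body .toCotree [.num b.toNat, c.toVal])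
      (.ret (c.toCotree b).toVal) (19 * c.nodes - 9)) (b : Bool) :
    Red (body .toCotreeList [.num b.toNat, toValList cs])
      (.ret (Cotree.toValList (toCotreeList b cs))) (19 * nodesList cs + 2) := by
  induction cs with
  | nil => exact .nil <| .ifNil_nil <| .refl _
  | cons c cs ihcs =>
    simp only [List.mem_cons, forall_eq_or_imp] at ih
    have := c.nodes_pos
    exact Red.mono (.nil <| .ifNil_cons <| .head <| .tail <| .call (ih.1 b) <|
      .call (ihcs ih.2) <| .cons <| .refl _) (by simp only [nodesList]; omega)

theorem red_toCotree (t : Shape) (ht : Canon t) : ∀ b : Bool,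
    Red (body .toCotree [.num b.toNat, t.toVal]) (.ret (t.toCotree b).toVal)
      (19 * t.nodes - 9) := by
  induction ht with
  | leaf =>
    intro b
    exact Red.mono (.num <| .nil <| .tail <| .ifNil_nil <| .refl _) (by simp [nodes])
  | node cs two_le _ _ ih =>
    intro b
    have h := red_toCotreeList cs ih (!b)
    have hb : (!b).toNat = 1 - b.toNat := by cases b <;> rfl
    rw [hb] at h
    match cs, two_le with
    | c :: cs, _ =>
      exact Red.mono (.num <| .nil <| .tail <| .ifNil_cons <| .sub <| .call h <| .cons <|
        .refl _) (by simp only [nodes]; omega)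

/-- The spare unit accounts for the list cell that holds the tree. -/
theorem size_toVal (t : Shape) : ∀ b, (t.toCotree b).toVal.size + 1 ≤ 4 * t.nodes := by
  induction t using Shape.induction with
  | leaf => intro b; simp [toCotree, Cotree.toVal, Val.size, nodes]
  | node cs ih =>
    intro b
    suffices h : ∀ b, (Cotree.toValList (toCotreeList b cs)).size ≤ 4 * nodesList cs + 1 by
      have := h (!b)
      simp only [toCotree, Cotree.toVal, Val.size, nodes]
      omega
    intro b
    induction cs with
    | nil => simp [toCotreeList, Cotree.toValList, Val.size]
    | cons c cs ihcs =>
      simp only [List.mem_cons, forall_eq_or_imp] at ih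
      have h1 := ihcs ih.2
      have h2 := ih.1 b
      simp only [toCotreeList, Cotree.toValList, Val.size, nodesList]
      omega

end Shape

-- The next partition, the search for the pivot and the climb in linear time

namespace Shape

open Code (body)
open Val (ofList ofList_append ofNats)

theorem _root_.Partition.IsPart.length_le {s : ℕ} {a : List ℕ} (h : Partition.IsPart 1 s a) :
    a.length ≤ s := by
  have := List.length_le_sum_of_one_le a h.le
  rwa [h.sum_eq] at this

/-- Two parts would make the greatest partition, and three or more parts that are all at least ⌊s/2⌋
force s = 3. This is why the algorithm has a special case for (1, 1, 1). -/
theorem _root_.Partition.IsPart.eq_of_head {s x : ℕ} {r : List ℕ}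
    (h : Partition.IsPart 1 s (x :: r)) (hr : r ≠ []) (hg : x :: r ≠ Partition.greatest s)
    (hx : x = s / 2) : x :: r = [1, 1, 1] ∧ s = 3 := by
  have hsum := h.sum_eq
  have hle := h.le
  have hs := h.sorted
  match r, hr with
  | [y], _ =>
    exfalso
    apply hg
    simp at hsum
    simp only [Partition.greatest, List.cons.injEq, and_true]
    omega
  | y :: z :: r, _ =>
    have := h.length_le
    simp at hsum hle hs this
    have hs3 : s = 3 := by omega
    have hr : r.length = 0 := by omega
    obtain rfl := List.length_eq_zero_iff.1 hr
    simp at hsum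
    simp only [List.cons.injEq, and_true]
    omega

theorem red_nextPartition {s : ℕ} {a : List ℕ} (ha : Partition.IsPart 1 s a)
    (h2 : 2 ≤ a.length) (hg : a ≠ Partition.greatest s) :
    Red (body .nextPartition [ofNats a]) (.ret (ofNats (Partition.next a))) (40 * s + 40) := by
  have hlen := ha.length_le
  have hsum := red_sum a 0
  rw [zero_add, ha.sum_eq] at hsum
  obtain ⟨x₁, r, rfl⟩ := List.exists_cons_of_ne_nil ha.ne_nil
  have hr : r ≠ [] := by rintro rfl; simp at h2
  by_cases hx : x₁ = s / 2
  · obtain ⟨h3, rfl⟩ := ha.eq_of_head hr hg hx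
    rw [h3] at hsum ⊢
    exact Red.mono (.num <| .num <| .num <| .num <| .nil <| .call hsum <| .head <| .div <|
      .ifEq_pos rfl <| .ifEq_pos rfl <| .tail <| .head <| .add <| .div <|
      .ifEq_neg (by decide) <| .cons <| .cons <| .refl _) (by simp)
  · obtain ⟨f, x, y, hf⟩ : ∃ f x y, x₁ :: r = f ++ [x, y] := by
      obtain ⟨l, y, hl⟩ := List.eq_nil_or_concat' (x₁ :: r) |>.resolve_left (by simp)
      rcases List.eq_nil_or_concat' l with rfl | ⟨f, x, rfl⟩
      · rw [hl] at h2
        simp at h2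
      · exact ⟨f, x, y, by rw [hl]; simp⟩
    have hfs : f.length + 2 ≤ s := by
      rw [hf] at hlen
      simpa using hlen
    have hys : y ≤ s := by
      have := ha.sum_eq
      rw [hf] at this
      simp at this
      omega
    have hrev := red_revAppend ((f ++ [x, y]).map .num) .nil
    simp only [List.map_append, List.map_cons, List.map_nil, List.reverse_append,
      List.reverse_cons, List.reverse_nil, List.nil_append, List.cons_append,
      List.length_append, List.length_map, List.length_cons, List.length_nil] at hrev
    have hfront := fun z => red_revAppend (f.map Val.num).reverse z
    simp only [List.reverse_reverse, List.length_reverse, List.length_map] at hfront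
    have hnext : ofNats (Partition.next (f ++ [x, y])) =
        ofList (f.map .num) (ofNats (Partition.next [x, y])) := by
      rw [Partition.next_append, ofNats, List.map_append, ofList_append]
      rfl
    have hv : ofNats (f ++ [x, y]) = ofList (f.map .num ++ [.num x, .num y]) .nil := by
      simp [ofNats]
    rw [hf] at hsum ⊢
    have hhead : (ofNats (f ++ [x, y])).head.toNat = x₁ := by rw [← hf]; rfl
    have hlf : (f ++ [x, y]).length = f.length + 2 := by simp
    rw [hlf] at hsum
    rw [hnext]
    rw [← hv] at hrev
    by_cases hd : y - x ≤ 1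
    · have hp : Partition.next [x, y] = [x + y] := if_pos hd
      rw [hp]
      exact Red.mono (.num <| .num <| .num <| .num <| .nil <| .call hsum <| .head <| .div <|
        .ifEq_neg (by rw [hhead]; exact hx) <| .call hrev <| .head <| .tail <| .head <| .tail <|
        .sub <| .ifLe_pos hd <| .add <| .cons <| .jump <| hfront _) (by omega)
    · have hp : Partition.next [x, y] =
          List.replicate ((y - 1) / (x + 1)) (x + 1) ++ [x + 1 + (y - 1) % (x + 1)] := by
        rw [Partition.next, if_neg hd, Partition.least]
        -- Splitting off one part x + 1 turns the quotient and remainder in `least` into those that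
        -- the code computes from y - 1.
        have : x + y = y - 1 + (x + 1) := by omega
        rw [this, Nat.add_div_right _ (by omega), Nat.add_mod_right]
        rfl
      have hq : 1 ≤ (y - 1) / (x + 1) := (Nat.one_le_div_iff (by omega)).2 (by omega)
      have hqs : (y - 1) / (x + 1) ≤ s := (Nat.div_le_self _ _).trans (by omega)
      rw [hp]
      by_cases h1 : (y - 1) / (x + 1) ≤ 1
      · have hq1 : (y - 1) / (x + 1) = 1 := by omega
        have hm := Nat.div_add_mod (y - 1) (x + 1)
        have hl : x + 1 + (y - 1) % (x + 1) = y - 1 := by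
          rw [hq1] at hm
          omega
        rw [hq1, hl]
        exact Red.mono (.num <| .num <| .num <| .num <| .nil <| .call hsum <| .head <| .div <|
          .ifEq_neg (by rw [hhead]; exact hx) <| .call hrev <| .head <| .tail <| .head <|
          .tail <| .sub <| .ifLe_neg hd <| .add <| .sub <| .div <| .mod <| .ifLe_pos h1 <|
          .cons <| .cons <| .jump <| hfront _) (by omega)
      · have hw : ∀ q z, ofNats (List.replicate q (x + 1) ++ [z]) =
            ofList (List.replicate q (.num (x + 1))) (.cons (.num z) .nil) := fun q z => by
          rw [ofNats, List.map_append, List.map_replicate, ofList_append]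
          rfl
        rw [hw]
        exact Red.mono (.num <| .num <| .num <| .num <| .nil <| .call hsum <| .head <| .div <|
          .ifEq_neg (by rw [hhead]; exact hx) <| .call hrev <| .head <| .tail <| .head <|
          .tail <| .sub <| .ifLe_neg hd <| .add <| .sub <| .div <| .mod <| .ifLe_neg h1 <|
          .add <| .cons <| .call (red_repeatPush ((y - 1) / (x + 1)) _ _) <| .jump <| hfront _) (by omega)

/-- What the search for the pivot achieves, in the subtree `v` and in linear time: it finds out
whether there is a next tree, and it prepares the climb that makes this tree. -/
def PivotSpec (v : Shape) : Prop :=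
  ∀ path, ∃ r, Red (body .findPivot [v.toVal, path]) (.ret r) (42 * v.nodes - 17) ∧
    (next v = none ∧ r = .nil ∨
      ∃ v' ps path', next v = some v' ∧ r = .cons (node ps).toVal path' ∧ Canon (node ps) ∧
        sizes ps ≠ Partition.greatest (sizes ps).sum ∧ (node ps).leaves ≤ v.leaves ∧
        Red (body .climb [(node ((Partition.next (sizes ps)).map star)).toVal, path'])
          (body .climb [v'.toVal, path]) (60 * v.nodes))

/-- One level of the climb. The label stored in the path stays correct because restarting preserves
the sizes of the siblings. -/
theorem red_climb {x : Shape} (hx : Canon x) (us ys : List Shape) (hy : ∀ y ∈ ys, Canon y)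
    (hxy : ∀ y ∈ ys, x.leaves ≤ y.leaves) (path : Val) :
    Red (body .climb [x.toVal, .cons (.cons (.num (leavesList (us ++ x :: ys)))
        (.cons (toValList us.reverse) (toValList ys))) path])
      (body .climb [(node (us ++ x :: restart x (sizes ys))).toVal, path])
      (17 + 60 * leavesList ys + 5 * us.length) := by
  have h1 := red_restart hx hy hxy
  have h2 := red_revAppend (us.reverse.map toVal) (toValList (x :: restart x (sizes ys)))
  have h3 : ofList (us.reverse.map toVal).reverse (toValList (x :: restart x (sizes ys))) =
      toValList (us ++ x :: restart x (sizes ys)) := by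
    rw [toValList_eq, toValList_eq, List.map_append, ofList_append]
    simp
  have h4 : leavesList (us ++ x :: restart x (sizes ys)) = leavesList (us ++ x :: ys) := by
    have hpos : ∀ m ∈ sizes ys, 1 ≤ m := by
      simpa [sizes] using fun y h => (hy y h).leaves_pos
    have := sizes_restart x hpos
    rw [leavesList_append, leavesList_append, leavesList_cons, leavesList_cons, leavesList_eq,
      leavesList_eq ys, leavesList_eq, this]
  rw [h3, ← toValList_eq] at h2
  rw [toVal, h4]
  exact Red.mono (.ifNil_cons <| .head <| .tail <| .head <| .tail <| .head <| .tail <|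
    .call h1 <| .cons <| .call h2 <| .cons <| .jump <| .refl _) (by simp; omega)

/-- Induction from the last child, with the invariant that the visited siblings have no successor.
Of the 17 units saved in `PivotSpec`, 12 pay for a pass of this loop; the 5 left per child pay for
reversing the list of children. -/
theorem red_findPivotAmong (us : List Shape) (ih : ∀ u ∈ us, PivotSpec u) :
    ∀ (vis : List Shape) (path : Val), (∀ c ∈ us ++ vis, Canon c) →
      (us ++ vis).Pairwise SibLE → nextList vis = none →
      ∃ r, Red (body .findPivotAmong [.num (leavesList (us ++ vis)), toValList us.reverse,
          toValList vis, path]) (.ret r) (42 * nodesList us - 5 * us.length + 2) ∧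
        (nextList (us ++ vis) = none ∧ r = .nil ∨
          ∃ cs' ps path', nextList (us ++ vis) = some cs' ∧ r = .cons (node ps).toVal path' ∧
            Canon (node ps) ∧ sizes ps ≠ Partition.greatest (sizes ps).sum ∧
            (node ps).leaves ≤ leavesList (us ++ vis) ∧
            Red (body .climb [(node ((Partition.next (sizes ps)).map star)).toVal, path'])
              (body .climb [(node cs').toVal, path]) (60 * (1 + nodesList (us ++ vis)))) := by
  induction us using List.reverseRecOn with
  | nil =>
    intro vis path _ _ hvis
    exact ⟨.nil, Red.mono (.nil <| .ifNil_nil <| .refl _) (by omega), .inl ⟨hvis, rfl⟩⟩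
  | append_singleton us v ihus =>
    intro vis path hc hs hvis
    have hlist : us ++ [v] ++ vis = us ++ v :: vis := by simp
    rw [hlist] at hc hs ⊢
    have hv := ih v (by simp)
    have hrev : toValList (us ++ [v]).reverse = .cons v.toVal (toValList us.reverse) := by
      rw [List.reverse_append, List.reverse_singleton, List.singleton_append, toValList]
    have hn : nodesList (us ++ [v]) = nodesList us + v.nodes := by
      simp [nodesList_append, nodesList]
    have hpos := v.nodes_pos
    have hlen := length_le_nodesList us
    have hcv : Canon v := hc v (by simp)
    have hcvis : ∀ c ∈ vis, Canon c := fun c h => hc c (by simp [h])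
    have hle : ∀ y ∈ vis, v.leaves ≤ y.leaves := fun y hy =>
      ((List.pairwise_cons.1 (List.pairwise_append.1 hs).2.1).1 y hy).leaves_le
    rw [hrev, hn, List.length_append, List.length_singleton]
    obtain ⟨r, hr, hcase⟩ := hv (.cons (.cons (.num (leavesList (us ++ v :: vis)))
        (.cons (toValList us.reverse) (toValList vis))) path)
    rcases hcase with ⟨hnone, rfl⟩ | ⟨v', ps, path', hsome, rfl, hps, hgr, hpv, hclimb⟩
    · have hvis' : nextList (v :: vis) = none := by rw [nextList, hvis, hnone]
      obtain ⟨r', hr', hcase'⟩ := ihus (fun u hu => ih u (by simp [hu])) (v :: vis) path hc hs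
        hvis'
      refine ⟨r', ?_, hcase'⟩
      exact Red.mono (.nil <| .ifNil_cons <| .head <| .tail <| .cons <| .cons <| .cons <|
        .call hr <| .ifNil_nil <| .cons <| .jump <| hr') (by omega)
    · refine ⟨_, Red.mono (.nil <| .ifNil_cons <| .head <| .tail <| .cons <| .cons <| .cons <|
        .call hr <| .ifNil_cons <| .refl _) (by omega), .inr ⟨us ++ v' :: restart v' (sizes vis),
          ps, path', ?_, rfl, hps, hgr, ?_, ?_⟩⟩
      · exact nextList_append us (by rw [nextList, hvis, hsome])
      · rw [leavesList_append, leavesList_cons]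
        omega
      · obtain ⟨hcv', hlv'⟩ := next_spec hcv hsome
        have h := red_climb hcv' us vis hcvis (by rwa [hlv']) path
        have hl : leavesList (us ++ v' :: vis) = leavesList (us ++ v :: vis) := by
          simp only [leavesList_append, leavesList_cons, hlv']
        rw [hl] at h
        -- Restarting the siblings after v is charged to their own nodes, disjoint from those of v,
        -- and the constant part to the parent.
        have hvn : leavesList vis ≤ nodesList vis := by
          clear * -
          induction vis with
          | nil => simp [leavesList]
          | cons c cs ih =>
            have := c.leaves_le_nodes
            rw [leavesList_cons, nodesList_cons]
            omega
        refine (hclimb.trans h).mono ?_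
        rw [nodesList_append, nodesList_cons]
        omega

theorem red_findPivot {v : Shape} (hv : Canon v) : PivotSpec v := by
  induction hv with
  | leaf =>
    intro path
    exact ⟨.nil, Red.mono (.num <| .num <| .nil <| .head <| .tail <| .ifNil_nil <| .refl _)
      (by simp [nodes]), .inl ⟨rfl, rfl⟩⟩
  | node cs two_le canon sorted ih =>
    intro path
    have hc : Canon (Shape.node cs) := .node cs two_le canon sorted
    obtain ⟨r, hr, hcase⟩ := red_findPivotAmong cs ih [] path (by simpa using canon)
      (by simpa using sorted) rfl
    rw [List.append_nil] at hr hcase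
    have hlen := length_le_nodesList cs
    have hrev := red_revAppend (cs.map toVal) .nil
    rw [← toValList_eq, ← List.map_reverse, ← toValList_eq, List.length_map] at hrev
    match cs, two_le with
    | c :: d :: cs, _ =>
    rcases hcase with ⟨hnone, rfl⟩ | ⟨cs', ps, path', hsome, rfl, hps, hgr, hle, hclimb⟩
    · have h1 : (toValList (c :: d :: cs)).head.head.toNat = c.leaves := by
        have : (toValList (c :: d :: cs)).head.head = .num c.leaves := head_toVal c
        rw [this]
        rfl
      have h2 : (toValList (c :: d :: cs)).tail.head.head.toNat = d.leaves := by
        have : (toValList (c :: d :: cs)).tail.head.head = .num d.leaves := head_toVal d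
        rw [this]
        rfl
      have hsum : (sizes (c :: d :: cs)).sum = leavesList (c :: d :: cs) :=
        (leavesList_eq _).symm
      have hpos : ∀ x ∈ cs, 1 ≤ x.leaves := fun x hx => (canon x (by simp [hx])).leaves_pos
      by_cases hg : sizes (c :: d :: cs) = Partition.greatest (sizes (c :: d :: cs)).sum
      · have hg' := hg
        rw [hsum] at hg'
        simp only [sizes, List.map_cons, Partition.greatest, List.cons.injEq] at hg'
        refine ⟨.nil, ?_, .inl ⟨by rw [next, hnone]; exact if_pos hg, rfl⟩⟩
        exact Red.mono (.num <| .num <| .nil <| .head <| .tail <| .ifNil_cons <| .call hrev <|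
          .call hr <| .ifNil_nil <| .cons <| .div <| .add <| .div <| .head <| .head <| .tail <|
          .head <| .head <| .ifEq_pos (h1.trans hg'.1) <| .ifEq_pos (h2.trans hg'.2.1) <|
          .refl _) (by simp only [nodes]; omega)
      · refine ⟨.cons (Shape.node (c :: d :: cs)).toVal path, ?_, .inr
          ⟨_, c :: d :: cs, path, by rw [next, hnone]; exact if_neg hg, rfl, hc, hg, le_rfl,
            (Red.refl _).mono (by omega)⟩⟩
        by_cases hlo : c.leaves = leavesList (c :: d :: cs) / 2
        · have hhi : d.leaves ≠ (leavesList (c :: d :: cs) + 1) / 2 := by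
            intro hhi
            apply hg
            have htot : leavesList (c :: d :: cs) = c.leaves + (d.leaves + leavesList cs) := rfl
            have hcs : cs = [] := by
              rcases cs with - | ⟨z, zs⟩
              · rfl
              · have := hpos z (by simp)
                have := leavesList_cons z zs
                omega
            subst hcs
            rw [hsum, Partition.greatest, ← hlo, ← hhi]
            rfl
          exact Red.mono (.num <| .num <| .nil <| .head <| .tail <| .ifNil_cons <|
            .call hrev <| .call hr <| .ifNil_nil <| .cons <| .div <| .add <| .div <| .head <|
            .head <| .tail <| .head <| .head <| .ifEq_pos (h1.trans hlo) <|
            .ifEq_neg (fun h => hhi (h2.symm.trans h)) <| .refl _)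
            (by simp only [nodes]; omega)
        · exact Red.mono (.num <| .num <| .nil <| .head <| .tail <| .ifNil_cons <|
            .call hrev <| .call hr <| .ifNil_nil <| .cons <| .div <| .add <| .div <| .head <|
            .head <| .tail <| .head <| .head <| .ifEq_neg (fun h => hlo (h1.symm.trans h)) <|
            .refl _) (by simp only [nodes]; omega)
    · refine ⟨_, Red.mono (.num <| .num <| .nil <| .head <| .tail <| .ifNil_cons <|
        .call hrev <| .call hr <| .ifNil_cons <| .refl _) (by simp only [nodes]; omega),
        .inr ⟨Shape.node cs', ps, path', by rw [next, hsome], rfl, hps, hgr, hle,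
          hclimb.mono (by simp only [nodes]; omega)⟩⟩

/-- The procedure `nextTree` computes the next tree in linear time. -/
theorem red_nextTree {t : Shape} (ht : Canon t) :
    Red (body .nextTree [t.toVal]) (.ret ((next t).elim .nil toVal)) (400 * t.leaves + 100) := by
  have hn := ht.nodes_lt
  obtain ⟨r, hr, hcase⟩ := red_findPivot ht .nil
  rcases hcase with ⟨hnone, rfl⟩ | ⟨t', ps, path', hsome, rfl, hps, hgr, hle, hclimb⟩
  · rw [hnone]
    exact Red.mono (.nil <| .call hr <| .ifNil_nil <| .refl _) (by omega)
  · rw [hsome]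
    cases hps with
    | node _ two_le canon sorted =>
      have hp := isPart_sizes (by rintro rfl; simp at two_le) canon sorted
      have hp' := Partition.isPart_next one_pos hp
      have hlen := hp.length_le
      have hind := red_inducedPartition ps
      have hnext := red_nextPartition hp (by simpa [sizes] using two_le) hgr
      have hreb := red_rebuildNode hp'.le
      rw [hp'.sum_eq, ← leavesList_eq] at hreb
      rw [leaves] at hle
      rw [← leavesList_eq] at hnext hlen
      have hl : ps.length = (sizes ps).length := by simp [sizes]
      have hend : Red (body .climb [t'.toVal, .nil]) (.ret t'.toVal) 1 :=
        .ifNil_nil <| .refl _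
      exact Red.mono (.nil <| .call hr <| .ifNil_cons <| .head <| .tail <| .head <| .tail <|
        .call hind <| .call hnext <| .call hreb <| .jump <| hclimb.trans hend) (by omega)

end Shape

/-! ## The main loop -/

/-- `Run c t w τ w'`: started at time `t` with the output `w`, the code `c` halts at time `τ` with
the output `w'`. -/
def Run (c : Code Val) (t : ℕ) (w : List (ℕ × Val)) (τ : ℕ) (w' : List (ℕ × Val)) : Prop :=
  ∃ (k : ℕ) (x : Val), State.step^[k] ⟨c, [], t, w⟩ = ⟨.ret x, [], τ, w'⟩

theorem Red.run {c d : Code Val} {T : ℕ} (h : Red c d T) (t : ℕ) (w : List (ℕ × Val)) :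
    ∃ t' ≤ t + T, ∀ {τ w'}, Run d t' w τ w' → Run c t w τ w' := by
  obtain ⟨k, t', h1, h2⟩ := h [] t w
  refine ⟨t', h1, ?_⟩
  rintro τ w' ⟨k', x, h3⟩
  exact ⟨k' + k, x, by rw [Function.iterate_add_apply, h2, h3]⟩

theorem Run.output {p : Code Val} {x : Val} {t τ : ℕ} {w w' : List (ℕ × Val)}
    (h : Run p (t + x.size) (w ++ [(t + x.size, x)]) τ w') : Run (.output x p) t w τ w' := by
  obtain ⟨k, y, h⟩ := h
  exact ⟨k + 1, y, by rw [Function.iterate_succ_apply]; exact h⟩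

namespace Shape

open Code (body)

/-- Distinct pairs of a type and a canonical shape give non-isomorphic graphs. -/
theorem isEmpty_iso {s t : Shape} {b b' : Bool} (hs : Canon s) (ht : Canon t)
    (h2 : 2 ≤ s.leaves) (h : s = t → b ≠ b') :
    IsEmpty ((s.toCotree b).graph ≃g (t.toCotree b').graph) := by
  refine ⟨fun e => ?_⟩
  obtain ⟨rfl, rfl | hb⟩ := eq_of_iso hs ht ⟨e⟩
  · simp [leaves] at h2
  · exact h rfl hb

/-- One pass through the loop. -/
theorem run_loop_pass {n : ℕ} (hn : 2 ≤ n) {t : Shape} (hc : Canon t) (hl : t.leaves = n)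
    (t₀ : ℕ) (w₀ : List (ℕ × Val)) :
    ∃ t₁ t₂ t₃, t₁ ≤ t₀ + 50 * n ∧ t₂ ≤ t₁ + 50 * n ∧ t₃ ≤ t₂ + 500 * n ∧
      ∀ {τ w'}, Run ((next t).elim (.ret .nil) fun t' => body .loop [t'.toVal]) t₃
          (w₀ ++ [(t₁, (t.toCotree false).toVal), (t₂, (t.toCotree true).toVal)]) τ w' →
        Run (body .loop [t.toVal]) t₀ w₀ τ w' := by
  have hnodes := hc.nodes_lt
  have hs0 := size_toVal t false
  have hs1 := size_toVal t true
  set c0 := (t.toCotree false).toVal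
  set c1 := (t.toCotree true).toVal
  have hnext := red_nextTree hc
  set last : Code Val := .call .nextTree [t.toVal] fun t' =>
    .ifNil t' (.ret t') <| .jump .loop [t']
  set middle : Code Val := .call .toCotree [.num 1, t.toVal] fun c => .output c last
  have r1 : Red (body .loop [t.toVal]) (.output c0 middle) (42 * n) :=
    Red.mono (.num <| .num <| .call (red_toCotree t hc false) <| .refl _) (by omega)
  have r2 : Red middle (.output c1 last) (42 * n) :=
    Red.mono (.call (red_toCotree t hc true) <| .refl _) (by omega)
  have r3 : Red last ((next t).elim (.ret .nil) fun t' => body .loop [t'.toVal]) (500 * n) := by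
    rcases ht' : next t with - | t' <;> rw [ht'] at hnext
    · exact Red.mono (.call hnext <| .ifNil_nil <| .refl _) (by omega)
    · refine Red.mono (.call hnext <| ?_) (T := 400 * t.leaves + 100 + 2 + 2) (by omega)
      obtain ⟨a, b, hab⟩ : ∃ a b, t'.toVal = .cons a b := by cases t' <;> exact ⟨_, _, rfl⟩
      change Red (.ifNil t'.toVal (.ret t'.toVal) (.jump .loop [t'.toVal]))
        (body .loop [t'.toVal]) 2
      rw [hab]
      exact .ifNil_cons <| .jump <| .refl _
  obtain ⟨u₁, hu1, run1⟩ := r1.run t₀ w₀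
  obtain ⟨u₂, hu2, run2⟩ := r2.run (u₁ + c0.size) (w₀ ++ [(u₁ + c0.size, c0)])
  obtain ⟨u₃, hu3, run3⟩ := r3.run (u₂ + c1.size)
    (w₀ ++ [(u₁ + c0.size, c0)] ++ [(u₂ + c1.size, c1)])
  refine ⟨u₁ + c0.size, u₂ + c1.size, u₃, by omega, by omega, by omega, fun h => ?_⟩
  refine run1 (.output (run2 (.output (run3 ?_))))
  simpa using h

/-- The loop outputs both cotrees of all trees from `t` on, with linear delay. -/
theorem run_loop {n : ℕ} (hn : 2 ≤ n) {t M : Shape} (hM : next M = none) (htM : Reach t M) :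
    Canon t → t.leaves = n → ∀ (t₀ : ℕ) (w₀ : List (ℕ × Val)),
    ∃ (S : List (ℕ × Cotree)) (τ : ℕ),
      Run (body .loop [t.toVal]) t₀ w₀ τ (w₀ ++ S.map fun p => (p.1, p.2.toVal)) ∧
      (∀ p ∈ S, ∃ b u, p.2 = toCotree b u ∧ Reach t u) ∧
      (∀ b u, Reach t u → ∃ p ∈ S, p.2 = toCotree b u) ∧
      S.Pairwise (fun p q => IsEmpty (p.2.graph ≃g q.2.graph)) ∧
      S.IsChain (fun p q => q.1 ≤ p.1 + 600 * n) ∧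
      (∀ p ∈ S.getLast?, τ ≤ p.1 + 600 * n) ∧
      (∀ p ∈ S.head?, p.1 ≤ t₀ + 50 * n) ∧ S ≠ [] := by
  induction htM using Relation.ReflTransGen.head_induction_on with
  | refl =>
    intro hc hl t₀ w₀
    obtain ⟨t₁, t₂, t₃, h1, h2, h3, hrun⟩ := run_loop_pass hn hc hl t₀ w₀
    refine ⟨[(t₁, M.toCotree false), (t₂, M.toCotree true)], t₃, hrun ?_, ?_, ?_, ?_, ?_, ?_, ?_,
      by simp⟩
    · rw [hM]
      exact ⟨0, .nil, rfl⟩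
    · simp only [List.mem_cons, forall_eq_or_imp, List.not_mem_nil, false_imp_iff, implies_true,
        and_true]
      exact ⟨⟨false, M, rfl, .refl⟩, ⟨true, M, rfl, .refl⟩⟩
    · intro b u hu
      rcases hu.cases_head with rfl | ⟨v, hv, -⟩
      · cases b <;> simp
      · simp [hM] at hv
    · simpa using isEmpty_iso hc hc (by omega) (by simp)
    · simpa using h2.trans (by omega)
    · simpa using h3.trans (by omega)
    · simpa using h1
  | @head t t' htt' htM ih =>
    intro hc hl t₀ w₀
    obtain ⟨hc', hl'⟩ := next_spec hc htt'
    obtain ⟨t₁, t₂, t₃, h1, h2, h3, hrun⟩ := run_loop_pass hn hc hl t₀ w₀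
    obtain ⟨S, τ, g1, g2, g3, g4, g5, g6, g7, g8⟩ := ih hc' (hl'.trans hl) t₃
      (w₀ ++ [(t₁, (t.toCotree false).toVal), (t₂, (t.toCotree true).toVal)])
    -- Later outputs come from trees reachable from t', and t is not among these because the
    -- sequence ends.
    have hne : ∀ b, ∀ p ∈ S, IsEmpty ((t.toCotree b).graph ≃g p.2.graph) := by
      intro b p hp
      obtain ⟨b', u, hpu, hu⟩ := g2 p hp
      rw [hpu]
      refine isEmpty_iso hc (hu.spec hc').1 (by omega) ?_
      rintro rfl
      exact absurd hu (not_reach_next hM (.head htt' htM) htt')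
    refine ⟨(t₁, t.toCotree false) :: (t₂, t.toCotree true) :: S, τ, hrun ?_, ?_, ?_, ?_, ?_, ?_,
      ?_, by simp⟩
    · rw [htt']
      simpa using g1
    · simp only [List.mem_cons, forall_eq_or_imp]
      refine ⟨⟨false, t, rfl, .refl⟩, ⟨true, t, rfl, .refl⟩, fun p hp => ?_⟩
      obtain ⟨b, u, hpu, hu⟩ := g2 p hp
      exact ⟨b, u, hpu, .head htt' hu⟩
    · intro b u hu
      rcases hu.cases_head with rfl | ⟨v, hv, hvu⟩
      · cases b <;> simp
      · obtain rfl : t' = v := by simpa [htt'] using hv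
        obtain ⟨p, hp, hpu⟩ := g3 b u hvu
        exact ⟨p, by simp [hp], hpu⟩
    · refine List.pairwise_cons.2 ⟨?_, List.pairwise_cons.2 ⟨hne true, g4⟩⟩
      simp only [List.mem_cons, forall_eq_or_imp]
      exact ⟨isEmpty_iso hc hc (by omega) (by simp), hne false⟩
    · refine List.isChain_cons.2 ⟨?_, List.isChain_cons.2 ⟨fun p hp => ?_, g5⟩⟩
      · simpa using h2.trans (by omega)
      · have := g7 p hp
        dsimp only
        omega
    · intro p hp
      refine g6 p ?_
      rwa [List.getLast?_cons_cons, List.getLast?_cons_of_ne_nil g8] at hp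
    · simpa using h1

end Shape

-- Assembly

theorem mainTheorem1 :
    ∃ C : ℕ, ∀ n : ℕ, 2 ≤ n →
      -- the outputs of the run on `n`, with their times, and the time at which the run halts
      ∃ (S : List (ℕ × Cotree)) (τ : ℕ),
        Generates n (S.map fun p => (p.1, p.2.toVal)) τ ∧
        -- (a) the outputs are cotrees with `n` leaves, and all of them occur
        (∀ p ∈ S, p.2.IsCotree ∧ p.2.numLeaves = n) ∧
        (∀ c : Cotree, c.IsCotree → c.numLeaves = n → ∃ p ∈ S, c.SibEquiv p.2) ∧
        -- (b) the associated graphs are cographs with `n` vertices, all of them occur,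
        -- and no two are isomorphic
        (∀ p ∈ S, IsCograph p.2.graph ∧ Nat.card p.2.Vert = n) ∧
        (∀ (V : Type*) (G : SimpleGraph V), IsCograph G → Nat.card V = n →
          ∃ p ∈ S, Nonempty (G ≃g p.2.graph)) ∧
        S.Pairwise (fun p q => IsEmpty (p.2.graph ≃g q.2.graph)) ∧
        -- (c) the delay
        S.IsChain (fun p q => q.1 ≤ p.1 + C * n) ∧
        (∀ p ∈ S.getLast?, τ ≤ p.1 + C * n) ∧
        -- (d) the time of the first output
        (∀ p ∈ S.head?, p.1 ≤ C * n) := by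
  -- Between two trees at most 500n units are spent on the next tree and 50n on its first output.
  -- The initial tree takes at most 33n + 16 units, so 600n also covers the first output.
  refine ⟨600, fun n hn => ?_⟩
  obtain ⟨M, -, -, hM, hall⟩ := Shape.exists_endsAt n (by omega)
  have hstar := Shape.canon_star n
  have hsl := Shape.leaves_star (m := n) (by omega)
  have hsn : Shape.star n = .node ((List.replicate n 1).map Shape.star) := by
    rw [Shape.star, if_neg (by omega)]
    simp [Shape.star]
  have hreb := Shape.red_rebuildNode (a := List.replicate n 1) (by simp)
  have hsum : (List.replicate n 1).sum = n := by simp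
  rw [hsum, ← hsn] at hreb
  have hinit : Red (.jump .cographGeneration [.num n])
      (Code.body .loop [(Shape.star n).toVal]) (33 * n + 16) :=
    Red.mono (.jump <| .call (Shape.red_ones n) <| .call hreb <| .jump <| .refl _) (by omega)
  obtain ⟨t₀, ht₀, hrun⟩ := hinit.run 0 []
  obtain ⟨S, τ, h1, h2, h3, h4, h5, h6, h7, -⟩ :=
    Shape.run_loop hn hM (hall _ hstar hsl).2 hstar hsl t₀ []
  have hcot : ∀ p ∈ S, p.2.IsCotree ∧ p.2.numLeaves = n := by
    intro p hp
    obtain ⟨b, u, hpu, hu⟩ := h2 p hp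
    obtain ⟨hc, hl⟩ := hu.spec hstar
    rw [hpu]
    exact ⟨hc.isCotree b, by rw [Shape.numLeaves_toCotree, hl, hsl]⟩
  have hocc : ∀ c : Cotree, c.IsCotree → c.numLeaves = n → ∃ p ∈ S, c.SibEquiv p.2 := by
    intro c hc hcn
    obtain ⟨u, hu, hcu⟩ := Shape.exists_canon hc
    -- The type b is that of the root; for a leaf either value would do.
    obtain ⟨b, hb⟩ : ∃ b, c.rootType ≠ some (!b) := by
      rcases hr : c.rootType with - | b
      · exact ⟨true, by simp⟩
      · exact ⟨b, by simp⟩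
    have hcb := hcu b hb
    obtain ⟨e⟩ := hcb.graph_iso
    have hul : u.leaves = n := by
      rw [← hcn, ← Shape.numLeaves_toCotree u b, ← c.card_vert.2, ← (Cotree.card_vert _).2]
      exact (Nat.card_congr e.toEquiv).symm
    obtain ⟨p, hp, hpu⟩ := h3 b u (hall u hu hul).1
    exact ⟨p, hp, hpu ▸ hcb⟩
  refine ⟨S, τ, hrun h1, hcot, hocc, fun p hp => ⟨(hcot p hp).1.isCograph, ?_⟩, ?_, h4, h5, h6,
    fun p hp => (h7 p hp).trans (by omega)⟩
  · rw [(Cotree.card_vert _).2, (hcot p hp).2]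
  · intro V G hG hV
    obtain ⟨c, hc, ⟨e⟩⟩ := hG.exists_cotree
    have hcn : c.numLeaves = n := by
      rw [← c.card_vert.2, ← hV]
      exact (Nat.card_congr e.toEquiv).symm
    obtain ⟨p, hp, hcp⟩ := hocc c hc hcn
    obtain ⟨f⟩ := hcp.graph_iso
    exact ⟨p, hp, ⟨e.trans f⟩⟩
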